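/- Setting. Let $E$ be a finite nonempty set, $n=|E|$, let $\mathcal M=(E,\mathcal I)$ be a matroid of rank $r\ge 1$, and let $f:2^E\to\mathbb R_{\ge 0}$ be submodular (monotone or not), i.e. $f(A)+f(B)\ge f(A\cup B)+f(A\cap B)$ for all $A,B\subseteq E$. Write $f_S(i)=f(S\cup\{i\})-f(S)$, $\bar d=\max_{i\in E}f(\{i\})$, $\underline d=-\min_{S\subseteq E,\,i\in E}f_S(i)\ge 0$, and $f(OPT)=\max_{S\in\mathcal I}f(S)$. Assume $\bar d>0$ and $f(\{e\})\le f(OPT)$ for every $e\in E$ with $\{e\}\notin\mathcal I$ (this is no condition if $\mathcal M$ has no loops). Let $P(\mathcal M)$ be the convex hull of the incidence vectors of the sets in $\mathcal I$. For $\mathbf y\in[0,1]^E$ let $R(\mathbf y)$ be the random set that contains each $i\in E$ independently with probability $y_i$, and let $F(\mathbf y)=\mathbb E[f(R(\mathbf y))]$ be the multilinear extension of $f$. For $B\subseteq E$ and $\delta\in[0,1]$ let $\mathbf y(B,\delta)$ be the point with coordinates $1+e^{-\delta}(y_i-1)$ for $i\in B$ and $y_i$ for $i\notin B$. Algorithm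 (accelerated measured continuous greedy). Let $\epsilon=1/N$ with $N\ge1$ an integer, let $m\ge1$ be an integer (the number of samples per estimate), and fix any ordering of $E$. Put $\delta=\epsilon$, $\mathbf y(0)=\mathbf 0$, and for $t=0,\delta,2\delta,\dots,1-\delta$ put $\mathbf y(t+\delta)=\mathbf y(t)(B,\delta)$, where $B$ is the output of Decreasing-Threshold at $\mathbf y=\mathbf y(t)$; return $\mathbf y^*=\mathbf y(1)$. Decreasing-Threshold at $\mathbf y$: start with $B=\emptyset$ and put $\bar y'=\max_{i\in E}(1+e^{-\delta}(y_i-1))$. For $w=\bar d,\ \bar d(1-\epsilon),\ \bar d(1-\epsilon)^2,\dots$, as long as $w\ge\epsilon\frac{\bar d}{r}(1-\bar y')$, go through all $e\in E$ in the given order; for each $e$ let $w_e$ be the average of $f_R(e)$ over $m$ fresh independent samples $R$ of $R(\mathbf y(B,\delta))$, and if $w_e\ge w$ and $B\cup\{e\}\in\mathcal I$, replace $B$ by $B\cup\{e\}$. Return $B$. Theorem. For every $c>0$ there is a constant $C>0$, depending only on $c$, such that for all $E,\mathcal M,f,\epsilon$ and orderings as above and all $$m\ \ge\ C\,\frac{r^2}{\epsilon^2}\Big(\frac{\bar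 d+\underline d}{\bar d}\Big)^2\log n ,$$ the algorithm always returns a point $\mathbf y^*\in P(\mathcal M)$, and with probability at least $1-\epsilon^{-3}n^{-c}$ over the sampling $$F(\mathbf y^*)\ \ge\ \Big(\frac1e-2\epsilon\Big)f(OPT).$$ -/

import Mathlib

universe u

open scoped ENNReal

namespace AccelGreedy

noncomputable section

section Setup

variable {E : Type u} [Fintype E] [DecidableEq E]

/-- Submodularity of a set function on the finite ground set `E`. -/
def IsSubmodular (f : Finset E → ℝ) : Prop :=
  ∀ A B : Finset E, f (A ∪ B) + f (A ∩ B) ≤ f A + f B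

/-- The marginal value `f_S(e) = f(S + e) - f(S)`. -/
def marginal (f : Finset E → ℝ) (S : Finset E) (e : E) : ℝ :=
  f (insert e S) - f S

/-- The matroid polytope: convex hull of the incidence vectors of the independent sets. -/
def matroidPolytope (M : Matroid E) : Set (E → ℝ) :=
  convexHull ℝ {x | ∃ S : Finset E, M.Indep (S : Set E) ∧ x = fun i => if i ∈ S then 1 else 0}

/-- The rank of the matroid, as a natural number. -/
def rk (M : Matroid E) : ℕ := M.eRank.toNat

/-- The probability that the random set `R(y)` is equal to `S`. -/
def weight (y : E → ℝ) (S : Finset E) : ℝ :=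
  (∏ i ∈ S, y i) * ∏ j ∈ Sᶜ, (1 - y j)

/-- The multilinear extension of `f`. -/
def multilinearExt (f : Finset E → ℝ) (y : E → ℝ) : ℝ :=
  ∑ S : Finset E, f S * weight y S

theorem weight_nonneg (y : E → unitInterval) (S : Finset E) :
    0 ≤ weight (fun i => (y i : ℝ)) S :=
  mul_nonneg (Finset.prod_nonneg fun i _ => (y i).2.1)
    (Finset.prod_nonneg fun i _ => sub_nonneg.2 (y i).2.2)

theorem sum_weight (y : E → ℝ) : ∑ S : Finset E, weight y S = 1 := by
  have h := Finset.prod_add y (fun i => 1 - y i) (Finset.univ : Finset E)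
  simp only [add_sub_cancel, Finset.prod_const_one, Finset.powerset_univ] at h
  rw [h]
  refine Finset.sum_congr rfl fun S _ => ?_
  rw [weight, Finset.compl_eq_univ_sdiff]

theorem sum_ofReal_weight (y : E → unitInterval) :
    ∑ S : Finset E, ENNReal.ofReal (weight (fun i => (y i : ℝ)) S) = 1 := by
  rw [← ENNReal.ofReal_sum_of_nonneg fun S _ => weight_nonneg y S, sum_weight,
    ENNReal.ofReal_one]

/-- The law of the random set `R(y)`, which contains each `i` independently with
probability `y i`. -/
def randomSet (y : E → unitInterval) : PMF (Finset E) :=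
  PMF.ofFintype (fun S => ENNReal.ofReal (weight (fun i => (y i : ℝ)) S)) (sum_ofReal_weight y)

/-- `m` independent samples from the law `p`. -/
def iidSamples {α : Type u} (p : PMF α) : ℕ → PMF (List α)
  | 0 => PMF.pure []
  | m + 1 => p.bind fun x => (iidSamples p m).bind fun l => PMF.pure (x :: l)

/-- The random estimate of `ΔF_e(y) = E[f_{R(y)}(e)]`: the average of the marginal values of `e`
at `m` independent samples of `R(y)`. -/
def estimate (f : Finset E → ℝ) (m : ℕ) (y : E → unitInterval) (e : E) : PMF ℝ :=
  (iidSamples (randomSet y) m).map fun l => (l.map fun R => marginal f R e).sum / m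

theorem stepCoord_mem (δ x : unitInterval) :
    1 + Real.exp (-(δ : ℝ)) * ((x : ℝ) - 1) ∈ Set.Icc (0 : ℝ) 1 := by
  have h0 := Real.exp_pos (-(δ : ℝ))
  have h1 : Real.exp (-(δ : ℝ)) ≤ 1 := Real.exp_le_one_iff.2 (neg_nonpos.2 δ.2.1)
  have hx0 : (0 : ℝ) ≤ x := x.2.1
  have hx1 : (x : ℝ) ≤ 1 := x.2.2
  constructor <;> nlinarith

/-- The update `x ↦ 1 + e^{-δ} (x - 1)` of one coordinate. -/
def stepCoord (δ x : unitInterval) : unitInterval :=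
  ⟨1 + Real.exp (-(δ : ℝ)) * ((x : ℝ) - 1), stepCoord_mem δ x⟩

/-- The point `y(B, δ)`: the coordinates in `B` are updated, the others are unchanged. -/
def stepPoint (δ : unitInterval) (y : E → unitInterval) (B : Finset E) : E → unitInterval :=
  fun i => if i ∈ B then stepCoord δ (y i) else y i

/-- The maximal singleton value `d̄ = max_i f({i})`. -/
def dUpper [Nonempty E] (f : Finset E → ℝ) : ℝ :=
  Finset.univ.sup' Finset.univ_nonempty fun i : E => f {i}

/-- The absolute value of the minimal marginal value, `- min_{S, i} f_S(i)`. It is nonnegative,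
because `f_S(i) = 0` for `i ∈ S`. -/
def dLower [Nonempty E] (f : Finset E → ℝ) : ℝ :=
  Finset.univ.sup' Finset.univ_nonempty fun p : Finset E × E => -marginal f p.1 p.2

/-- The number `max_i (1 + e^{-δ} (y_i - 1))`. -/
def yBar [Nonempty E] (δ : unitInterval) (y : E → unitInterval) : ℝ :=
  Finset.univ.sup' Finset.univ_nonempty fun i : E => (stepCoord δ (y i) : ℝ)

open scoped Classical in
/-- One pass of Decreasing-Threshold with threshold `w` over the elements listed in `order`,
starting from the set `B`. Each test uses a fresh estimate. -/
def thresholdPass (M : Matroid E) (f : Finset E → ℝ) (m : ℕ) (δ : unitInterval)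
    (y : E → unitInterval) (w : ℝ) : List E → Finset E → PMF (Finset E)
  | [], B => PMF.pure B
  | e :: order, B =>
    (estimate f m (stepPoint δ y B) e).bind fun x =>
      thresholdPass M f m δ y w order
        (if w ≤ x ∧ M.Indep ((insert e B : Finset E) : Set E) then insert e B else B)

/-- The first `k` passes of Decreasing-Threshold, with thresholds
`d̄, d̄ (1 - ε), d̄ (1 - ε)², …`, starting from the empty set. -/
def thresholdLoop [Nonempty E] (M : Matroid E) (f : Finset E → ℝ) (m : ℕ) (order : List E)
    (ε δ : unitInterval) (y : E → unitInterval) : ℕ → PMF (Finset E)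
  | 0 => PMF.pure ∅
  | k + 1 => (thresholdLoop M f m order ε δ y k).bind fun B =>
      thresholdPass M f m δ y (dUpper f * (1 - (ε : ℝ)) ^ k) order B

/-- The number of passes of Decreasing-Threshold: the first `k` for which the threshold
`d̄ (1 - ε) ^ k` is below the stopping value `ε (d̄ / r) (1 - ȳ')`. -/
def numPasses [Nonempty E] (M : Matroid E) (f : Finset E → ℝ) (ε δ : unitInterval)
    (y : E → unitInterval) : ℕ :=
  sInf {k : ℕ | dUpper f * (1 - (ε : ℝ)) ^ k < ε * (dUpper f / rk M) * (1 - yBar δ y)}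

/-- The (random) output of Decreasing-Threshold. -/
def decreasingThreshold [Nonempty E] (M : Matroid E) (f : Finset E → ℝ) (m : ℕ) (order : List E)
    (ε δ : unitInterval) (y : E → unitInterval) : PMF (Finset E) :=
  thresholdLoop M f m order ε δ y (numPasses M f ε δ y)

/-- The (random) point `y(k δ)` reached after `k` steps of the main loop, with `δ = ε`. -/
def greedyLoop [Nonempty E] (M : Matroid E) (f : Finset E → ℝ) (m : ℕ) (order : List E)
    (ε : unitInterval) : ℕ → PMF (E → unitInterval)
  | 0 => PMF.pure fun _ => 0
  | k + 1 => (greedyLoop M f m order ε k).bind fun y =>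
      (decreasingThreshold M f m order ε ε y).bind fun B => PMF.pure (stepPoint ε y B)

/-- The (random) output `y(1)` of the accelerated measured continuous greedy algorithm: the main
loop runs over `t = 0, ε, 2ε, …, 1 - ε`, that is, it makes `1 / ε` steps. -/
def acceleratedGreedy [Nonempty E] (M : Matroid E) (f : Finset E → ℝ) (m : ℕ) (order : List E)
    (ε : unitInterval) : PMF (E → unitInterval) :=
  greedyLoop M f m order ε ⌊1 / (ε : ℝ)⌋₊

end Setup

end

end AccelGreedy

/-!
The multilinear extension `F` of a submodular `f` is affine in each coordinate, with partial
derivatives that are antitone, and it is concave along rays from the origin. The latter gives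
`𝔼 f(R(y) ∪ OPT) ≥ (1 - max y) f(OPT)` (`IsSubmodular.le_multilinearExt_union`). After `k` steps
of length `ε` all coordinates are at most `1 - e^{-kε}`, so the expected marginal values of the
elements of `OPT` at `R(y)` sum up to at least `e^{-kε} f(OPT) - F(y)`.

Adding `e` to `B` raises `F(y(B, ε))` by `1 - e^{-ε}` times the expected marginal value of `e`
(`multilinearExt_stepPoint_insert`). Decreasing-Threshold is analysed by charging `OPT` to `B`
(`ThresholdInv`): a part `O` of `OPT`, initially all of it, is kept with `B ∪ O` independent.
When `b` enters `B`, the exchange property displaces at most one element `o` of `O`. As `o` could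
still be added to `B`, it was rejected at the previous threshold (and `d̄`, the first threshold,
bounds all values), so its expected marginal value is at most about `1 / (1 - ε)` times that of
`b`. The charges use positive parts of expected marginal values (`posGain`), which unlike the
values themselves are antitone in `y`. The elements of `O` left at the end have values below the
last threshold, hence in total at most about `ε d̄ ≤ ε f(OPT)`.

Altogether `e^{kε} F(y_k)` grows by almost `ε f(OPT)` in each step (`LoopInv`); after `1 / ε` steps
`F(y) ≥ (1 / e - 2ε) f(OPT)`. All this holds if all estimates are correct up to `s = ε d̄ / (4 r)`.
An estimate fails with probability at most `2 exp(- m s² / (4 (d̄ + d̲)²))`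
(`estimate_toOuterMeasure_le`), and the union bound over at most `2 ε⁻³ r n` estimates, in the form
`toOuterMeasure_bind_not_le`, finishes the proof.
-/

namespace AccelGreedy

/-! ### Submodular functions and the update of a point -/

section SetFunctions

variable {E : Type u} [DecidableEq E]

/-- The discrete derivative of a set function in the direction `e`. Unlike the marginal value
`marginal f S e`, it does not depend on whether `e ∈ S`; its multilinear extension is the partial
derivative of the multilinear extension of `f`. -/
def discDeriv (f : Finset E → ℝ) (e : E) (S : Finset E) : ℝ :=
  f (insert e S) - f (S.erase e)

theorem IsSubmodular.discDeriv_antitone {f : Finset E → ℝ} (hf : IsSubmodular f) (e : E) :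
    Antitone (discDeriv f e) := by
  intro S T hST
  have h := hf (insert e S) (T.erase e)
  have h1 : insert e S ∪ T.erase e = insert e T := by
    ext x
    have := @hST x
    simp only [Finset.mem_union, Finset.mem_insert, Finset.mem_erase]
    tauto
  have h2 : insert e S ∩ T.erase e = S.erase e := by
    ext x
    have := @hST x
    simp only [Finset.mem_inter, Finset.mem_insert, Finset.mem_erase]
    tauto
  rw [h1, h2] at h
  simp only [discDeriv]
  linarith

theorem IsSubmodular.sub_le_sum_marginal {f : Finset E → ℝ} (hf : IsSubmodular f)
    (S A : Finset E) : f (S ∪ A) - f S ≤ ∑ o ∈ A, marginal f S o := by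
  induction A using Finset.induction_on with
  | empty => simp
  | insert a A ha ih =>
    rw [Finset.sum_insert ha]
    have h := hf (S ∪ A) (insert a S)
    have h1 : S ∪ A ∪ insert a S = S ∪ insert a A := by
      ext x
      simp only [Finset.mem_union, Finset.mem_insert]
      tauto
    by_cases haS : a ∈ S
    · have h3 : S ∪ insert a A = S ∪ A := by
        ext x
        simp only [Finset.mem_union, Finset.mem_insert]
        constructor
        · rintro (h | rfl | h) <;> tauto
        · tauto
      rw [h3, marginal, Finset.insert_eq_of_mem haS]
      linarith
    · have h2 : (S ∪ A) ∩ insert a S = S := by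
        ext x
        simp only [Finset.mem_union, Finset.mem_insert, Finset.mem_inter]
        constructor
        · rintro ⟨h | h, rfl | h'⟩ <;> tauto
        · tauto
      rw [h1, h2] at h
      simp only [marginal] at ih ⊢
      linarith

theorem coe_stepPoint_mem (δ : unitInterval) (y : E → unitInterval) (B : Finset E) (i : E) :
    (stepPoint δ y B i : ℝ) ∈ Set.Icc (0 : ℝ) 1 :=
  (stepPoint δ y B i).2

theorem le_stepCoord (δ x : unitInterval) : (x : ℝ) ≤ stepCoord δ x := by
  have h1 : Real.exp (-(δ : ℝ)) ≤ 1 := Real.exp_le_one_iff.2 (neg_nonpos.2 δ.2.1)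
  have hx1 : (x : ℝ) ≤ 1 := x.2.2
  simp only [stepCoord]
  nlinarith

theorem stepPoint_mono (δ : unitInterval) (y : E → unitInterval) {A B : Finset E} (h : A ⊆ B)
    (i : E) : (stepPoint δ y A i : ℝ) ≤ stepPoint δ y B i := by
  by_cases hA : i ∈ A
  · simp [stepPoint, hA, h hA]
  · by_cases hB : i ∈ B
    · simpa [stepPoint, hA, hB] using le_stepCoord δ (y i)
    · simp [stepPoint, hA, hB]

theorem stepPoint_empty (δ : unitInterval) (y : E → unitInterval) : stepPoint δ y ∅ = y := by
  funext i
  simp [stepPoint]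

end SetFunctions

/-! ### The multilinear extension of a submodular function -/

section Multilinear

variable {E : Type u} [Fintype E] [DecidableEq E]

theorem weight_eq_prod (y : E → ℝ) (S : Finset E) :
    weight y S = ∏ i, if i ∈ S then y i else 1 - y i := by
  rw [weight, ← Finset.prod_mul_prod_compl S fun i => if i ∈ S then y i else 1 - y i]
  congr 1
  · exact Finset.prod_congr rfl fun i hi => by rw [if_pos hi]
  · exact Finset.prod_congr rfl fun i hi => by rw [if_neg (Finset.mem_compl.1 hi)]

theorem multilinearExt_eq_sum_powerset_erase (g : Finset E → ℝ) (y : E → ℝ) (a : E) :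
    multilinearExt g y = ∑ S ∈ (Finset.univ.erase a).powerset,
      ((1 - y a) * g S + y a * g (insert a S)) *
        ∏ i ∈ Finset.univ.erase a, if i ∈ S then y i else 1 - y i := by
  have ha : a ∉ (Finset.univ : Finset E).erase a := by simp
  rw [multilinearExt, ← Finset.powerset_univ, ← Finset.insert_erase (Finset.mem_univ a),
    Finset.sum_powerset_insert ha, ← Finset.sum_add_distrib]
  simp only [Finset.insert_erase (Finset.mem_univ a)]
  refine Finset.sum_congr rfl fun S hS => ?_
  have haS : a ∉ S := fun h => ha (Finset.mem_powerset.1 hS h)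
  rw [weight_eq_prod, weight_eq_prod, ← Finset.mul_prod_erase _ _ (Finset.mem_univ a),
    ← Finset.mul_prod_erase (a := a) (s := Finset.univ)
      (f := fun i => if i ∈ insert a S then y i else 1 - y i) (Finset.mem_univ a)]
  have h : ∏ i ∈ Finset.univ.erase a, (if i ∈ insert a S then y i else 1 - y i) =
      ∏ i ∈ Finset.univ.erase a, if i ∈ S then y i else 1 - y i :=
    Finset.prod_congr rfl fun i hi => by
      simp [Finset.mem_insert, Finset.ne_of_mem_erase hi]
  rw [h, if_neg haS, if_pos (Finset.mem_insert_self a S)]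
  ring

/-- Updating one coordinate to `v` means to condition on the membership of that element. -/
theorem multilinearExt_update (g : Finset E → ℝ) (y : E → ℝ) (a : E) (v : ℝ) :
    multilinearExt g (Function.update y a v) =
      (1 - v) * multilinearExt (fun S => g (S.erase a)) y +
        v * multilinearExt (fun S => g (insert a S)) y := by
  rw [multilinearExt_eq_sum_powerset_erase g _ a,
    multilinearExt_eq_sum_powerset_erase (fun S => g (S.erase a)) _ a,
    multilinearExt_eq_sum_powerset_erase (fun S => g (insert a S)) _ a,
    Finset.mul_sum, Finset.mul_sum, ← Finset.sum_add_distrib]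
  refine Finset.sum_congr rfl fun S hS => ?_
  have haS : a ∉ S := fun h => by simpa using Finset.mem_powerset.1 hS h
  have h : ∏ i ∈ Finset.univ.erase a, (if i ∈ S then Function.update y a v i
        else 1 - Function.update y a v i) =
      ∏ i ∈ Finset.univ.erase a, if i ∈ S then y i else 1 - y i :=
    Finset.prod_congr rfl fun i hi => by
      rw [Function.update_of_ne (Finset.ne_of_mem_erase hi)]
  rw [h, Function.update_self, Finset.erase_eq_of_notMem haS, Finset.erase_insert haS,
    Finset.insert_idem]
  ring

theorem multilinearExt_sub (g h : Finset E → ℝ) (y : E → ℝ) :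
    multilinearExt (fun S => g S - h S) y = multilinearExt g y - multilinearExt h y := by
  simp only [multilinearExt, sub_mul, Finset.sum_sub_distrib]

theorem multilinearExt_finset_sum {ι : Type*} (A : Finset ι) (g : ι → Finset E → ℝ) (y : E → ℝ) :
    multilinearExt (fun S => ∑ o ∈ A, g o S) y = ∑ o ∈ A, multilinearExt (g o) y := by
  simp only [multilinearExt, Finset.sum_mul]
  exact Finset.sum_comm

theorem multilinearExt_const (k : ℝ) (y : E → ℝ) : multilinearExt (fun _ => k) y = k := by
  rw [multilinearExt, ← Finset.mul_sum, sum_weight, mul_one]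

theorem weight_nonneg_of_mem_Icc {y : E → ℝ} (hy : ∀ i, y i ∈ Set.Icc (0 : ℝ) 1) (S : Finset E) :
    0 ≤ weight y S :=
  weight_nonneg (fun i => ⟨y i, hy i⟩) S

theorem multilinearExt_mono {g h : Finset E → ℝ} {y : E → ℝ}
    (hy : ∀ i, y i ∈ Set.Icc (0 : ℝ) 1) (hgh : ∀ S, g S ≤ h S) :
    multilinearExt g y ≤ multilinearExt h y :=
  Finset.sum_le_sum fun S _ => mul_le_mul_of_nonneg_right (hgh S) (weight_nonneg_of_mem_Icc hy S)

theorem multilinearExt_nonneg {g : Finset E → ℝ} {y : E → ℝ}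
    (hy : ∀ i, y i ∈ Set.Icc (0 : ℝ) 1) (hg : ∀ S, 0 ≤ g S) : 0 ≤ multilinearExt g y :=
  Finset.sum_nonneg fun S _ => mul_nonneg (hg S) (weight_nonneg_of_mem_Icc hy S)

theorem multilinearExt_zero (g : Finset E → ℝ) : multilinearExt g (fun _ => 0) = g ∅ := by
  rw [multilinearExt, Finset.sum_eq_single ∅]
  · simp [weight]
  · intro S _ hS
    obtain ⟨i, hi⟩ := Finset.nonempty_iff_ne_empty.2 hS
    rw [weight, Finset.prod_eq_zero hi rfl, zero_mul, mul_zero]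
  · simp

theorem multilinearExt_update_eq_add (g : Finset E → ℝ) (y : E → ℝ) (a : E) (v : ℝ) :
    multilinearExt g (Function.update y a v) =
      multilinearExt g y + (v - y a) * multilinearExt (discDeriv g a) y := by
  have h := multilinearExt_update g y a (y a)
  rw [Function.update_eq_self] at h
  rw [multilinearExt_update, h]
  have hd : multilinearExt (discDeriv g a) y = _ :=
    multilinearExt_sub (fun S => g (insert a S)) (fun S => g (S.erase a)) y
  rw [hd]
  ring

theorem multilinearExt_marginal (f : Finset E → ℝ) (y : E → ℝ) (e : E) :
    multilinearExt (fun S => marginal f S e) y =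
      (1 - y e) * multilinearExt (discDeriv f e) y := by
  have h := multilinearExt_update_eq_add f y e 1
  rw [multilinearExt_update] at h
  simp only [marginal]
  rw [multilinearExt_sub (fun S => f (insert e S)) f]
  linarith

theorem multilinearExt_antitone {g : Finset E → ℝ} (hg : Antitone g) {y z : E → ℝ}
    (hy : ∀ i, y i ∈ Set.Icc (0 : ℝ) 1) (hz : ∀ i, z i ∈ Set.Icc (0 : ℝ) 1)
    (hyz : ∀ i, y i ≤ z i) : multilinearExt g z ≤ multilinearExt g y := by
  suffices h : ∀ T : Finset E, multilinearExt g (T.piecewise z y) ≤ multilinearExt g y by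
    simpa using h Finset.univ
  intro T
  induction T using Finset.induction_on with
  | empty => simp
  | insert a T ha ih =>
    refine le_trans ?_ ih
    rw [Finset.piecewise_insert, multilinearExt_update_eq_add]
    have h1 : multilinearExt (discDeriv g a) (T.piecewise z y) ≤ 0 := by
      rw [← multilinearExt_const (0 : ℝ) (T.piecewise z y)]
      refine multilinearExt_mono (fun i => ?_) fun S => sub_nonpos.2 (hg ?_)
      · by_cases hi : i ∈ T
        · simpa [hi] using hz i
        · simpa [hi] using hy i
      · exact (Finset.erase_subset _ _).trans (Finset.subset_insert _ _)
    have h2 : 0 ≤ z a - T.piecewise z y a := by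
      rw [Finset.piecewise_eq_of_notMem _ _ _ ha]
      exact sub_nonneg.2 (hyz a)
    nlinarith

/-- Concavity of the multilinear extension of a submodular function along rays from the origin. -/
theorem IsSubmodular.le_multilinearExt_smul {f : Finset E → ℝ} (hf : IsSubmodular f)
    {p : ℝ} (hp0 : 0 ≤ p) (hp1 : p ≤ 1) {z : E → ℝ} (hz : ∀ i, z i ∈ Set.Icc (0 : ℝ) 1) :
    (1 - p) * f ∅ + p * multilinearExt f z ≤ multilinearExt f (fun i => p * z i) := by
  suffices h : ∀ T : Finset E, (1 - p) * f ∅ + p * multilinearExt f (T.piecewise z fun _ => 0) ≤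
      multilinearExt f (T.piecewise (fun i => p * z i) fun _ => 0) by
    simpa using h Finset.univ
  intro T
  induction T using Finset.induction_on with
  | empty =>
    simp only [Finset.piecewise_empty, multilinearExt_zero]
    linarith
  | insert a T ha ih =>
    rw [Finset.piecewise_insert, Finset.piecewise_insert, multilinearExt_update_eq_add,
      multilinearExt_update_eq_add, Finset.piecewise_eq_of_notMem _ _ _ ha,
      Finset.piecewise_eq_of_notMem _ _ _ ha]
    have hz' : ∀ i, T.piecewise z (fun _ => 0) i ∈ Set.Icc (0 : ℝ) 1 := fun i => by
      by_cases hi : i ∈ T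
      · simpa [hi] using hz i
      · simp [hi]
    have hpz : ∀ i, T.piecewise (fun i => p * z i) (fun _ => 0) i =
        p * T.piecewise z (fun _ => 0) i := fun i => by
      by_cases hi : i ∈ T <;> simp [hi]
    have h := multilinearExt_antitone (hf.discDeriv_antitone a)
      (y := T.piecewise (fun i => p * z i) (fun _ => 0)) (z := T.piecewise z fun _ => 0)
      (fun i => by
        rw [hpz]
        exact ⟨mul_nonneg hp0 (hz' i).1, mul_le_one₀ hp1 (hz' i).1 (hz' i).2⟩) hz'
      (fun i => by
        rw [hpz]
        exact mul_le_of_le_one_left (hz' i).1 hp1)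
    have h2 := mul_le_mul_of_nonneg_left h (mul_nonneg hp0 (hz a).1)
    linarith

/-- Adding a random set to `A` that contains no element with probability above `p` costs at most
the fraction `p` of `f A`, even if `f` is not monotone. -/
theorem IsSubmodular.le_multilinearExt_union {f : Finset E → ℝ} (hf : IsSubmodular f)
    (hf0 : ∀ S, 0 ≤ f S) (A : Finset E) {p : ℝ} (hp0 : 0 < p) (hp1 : p ≤ 1) {y : E → ℝ}
    (hy0 : ∀ i, 0 ≤ y i) (hyp : ∀ i, y i ≤ p) :
    (1 - p) * f A ≤ multilinearExt (fun S => f (S ∪ A)) y := by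
  have hg : IsSubmodular fun S => f (S ∪ A) := fun S T => by
    have h := hf (S ∪ A) (T ∪ A)
    rwa [← Finset.union_union_distrib_right, ← Finset.inter_union_distrib_right] at h
  have hz : ∀ i, y i / p ∈ Set.Icc (0 : ℝ) 1 := fun i =>
    ⟨div_nonneg (hy0 i) hp0.le, div_le_one_of_le₀ (hyp i) hp0.le⟩
  have h := hg.le_multilinearExt_smul hp0.le hp1 hz
  simp only [mul_div_cancel₀ _ hp0.ne', Finset.empty_union] at h
  have h2 : 0 ≤ p * multilinearExt (fun S => f (S ∪ A)) fun i => y i / p :=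
    mul_nonneg hp0.le (multilinearExt_nonneg hz fun S => hf0 _)
  linarith

/-- The positive part of the expected marginal value of `e` at `R(y)`. The expected marginal value
itself is not antitone in `y`, since it vanishes for `y e = 1`; the positive part is. -/
noncomputable def posGain (f : Finset E → ℝ) (y : E → ℝ) (e : E) : ℝ :=
  max 0 (multilinearExt (fun S => marginal f S e) y)

theorem posGain_nonneg (f : Finset E → ℝ) (y : E → ℝ) (e : E) : 0 ≤ posGain f y e :=
  le_max_left _ _

theorem IsSubmodular.posGain_antitone {f : Finset E → ℝ} (hf : IsSubmodular f) (e : E)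
    {y z : E → ℝ} (hy : ∀ i, y i ∈ Set.Icc (0 : ℝ) 1) (hz : ∀ i, z i ∈ Set.Icc (0 : ℝ) 1)
    (hyz : ∀ i, y i ≤ z i) : posGain f z e ≤ posGain f y e := by
  refine max_le (le_max_left _ _) ?_
  rw [posGain, multilinearExt_marginal, multilinearExt_marginal]
  have h := multilinearExt_antitone (hf.discDeriv_antitone e) hy hz hyz
  rcases le_total (multilinearExt (discDeriv f e) z) 0 with h0 | h0
  · exact le_max_of_le_left (mul_nonpos_of_nonneg_of_nonpos (sub_nonneg.2 (hz e).2) h0)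
  · exact le_max_of_le_right (mul_le_mul (by linarith [hyz e]) h h0 (sub_nonneg.2 (hy e).2))

theorem IsSubmodular.sub_le_sum_posGain {f : Finset E → ℝ} (hf : IsSubmodular f)
    (A : Finset E) {y : E → ℝ} (hy : ∀ i, y i ∈ Set.Icc (0 : ℝ) 1) :
    multilinearExt (fun S => f (S ∪ A)) y - multilinearExt f y ≤ ∑ o ∈ A, posGain f y o := by
  rw [← multilinearExt_sub]
  refine (multilinearExt_mono hy fun S => hf.sub_le_sum_marginal S A).trans ?_
  rw [multilinearExt_finset_sum A fun o S => marginal f S o]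
  exact Finset.sum_le_sum fun o _ => le_max_right _ _

/-- Adding `e` to `B` increases the value of the multilinear extension at `y(B, δ)` by the
fraction `1 - e^{-δ}` of the expected marginal value. -/
theorem multilinearExt_stepPoint_insert (f : Finset E → ℝ) (δ : unitInterval)
    (y : E → unitInterval) {B : Finset E} {e : E} (he : e ∉ B) :
    multilinearExt f (fun i => (stepPoint δ y (insert e B) i : ℝ)) =
      multilinearExt f (fun i => (stepPoint δ y B i : ℝ)) + (1 - Real.exp (-(δ : ℝ))) *
        multilinearExt (fun S => marginal f S e) (fun i => (stepPoint δ y B i : ℝ)) := by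
  have h : (fun i => (stepPoint δ y (insert e B) i : ℝ)) =
      Function.update (fun i => (stepPoint δ y B i : ℝ)) e (stepCoord δ (y e)) := by
    funext i
    by_cases hi : i = e
    · subst hi
      simp [stepPoint]
    · simp [stepPoint, hi]
  rw [h, multilinearExt_update_eq_add, multilinearExt_marginal]
  simp only [stepPoint, if_neg he, stepCoord]
  ring

end Multilinear

/-! ### Independent sets and the matroid polytope -/

section Matroids

theorem update_mem_matroidPolytope {E : Type u} [DecidableEq E] {M : Matroid E} {x : E → ℝ}
    (hx : x ∈ matroidPolytope M) {a : E} {v : ℝ} (hv : 0 ≤ v) (hvx : v ≤ x a) :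
    Function.update x a v ∈ matroidPolytope M := by
  have h0 : Function.update x a 0 ∈ matroidPolytope M := by
    have hlin : IsLinearMap ℝ fun x : E → ℝ => Function.update x a 0 := by
      constructor
      · intro x z
        funext i
        by_cases hi : i = a
        · subst hi; simp
        · simp [hi]
      · intro c x
        funext i
        by_cases hi : i = a
        · subst hi; simp
        · simp [hi]
    refine convexHull_min (t := (fun x : E → ℝ => Function.update x a 0) ⁻¹' matroidPolytope M)
      ?_ ((convex_convexHull ℝ _).is_linear_preimage hlin) hx
    rintro _ ⟨S, hS, rfl⟩
    refine subset_convexHull ℝ _ ⟨S.erase a, hS.subset (by simp), ?_⟩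
    funext i
    by_cases hi : i = a
    · subst hi; simp
    · simp [hi]
  rcases hv.eq_or_lt with rfl | hv'
  · exact h0
  have hxa : 0 < x a := hv'.trans_le hvx
  have h := convex_convexHull ℝ _ hx h0 (div_nonneg hv hxa.le)
    (sub_nonneg.2 (div_le_one_of_le₀ hvx hxa.le)) (add_sub_cancel _ _)
  suffices hv : Function.update x a v = _ by rw [hv]; exact h
  funext i
  by_cases hi : i = a
  · subst hi
    simp [div_mul_cancel₀ _ hxa.ne']
  · simp only [Function.update_of_ne hi, Pi.add_apply, Pi.smul_apply, smul_eq_mul]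
    ring

variable {E : Type u} [Fintype E]

theorem card_le_rk {M : Matroid E} {S : Finset E} (hS : M.Indep (S : Set E)) :
    S.card ≤ rk M := by
  have h := hS.encard_le_eRank
  rw [Set.encard_coe_eq_coe_finsetCard] at h
  have hfin : M.eRank ≠ ⊤ := ne_top_of_le_ne_top (Set.toFinite M.E).encard_lt_top.ne
    M.eRank_le_encard_ground
  rw [rk, ← ENat.natCast_le_natCast, ENat.natCast_toNat hfin]
  exact h

theorem rk_le_card (M : Matroid E) : rk M ≤ Fintype.card E := by
  have h := M.eRank_le_encard_ground.trans (Set.encard_le_encard (Set.subset_univ M.E))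
  rw [Set.encard_univ, ENat.card_eq_coe_fintype_card] at h
  exact ENat.toNat_le_of_le_natCast h

variable [DecidableEq E]

/-- If `B ∪ O` and `B + b` are independent, then `b` can be added to `B ∪ O` at the cost of at most
one element of `O`. -/
theorem exists_subset_indep_insert_union {M : Matroid E} {B O : Finset E} {b : E} (hb : b ∉ B)
    (hBO : Disjoint B O) (hind : M.Indep ((B ∪ O : Finset E) : Set E))
    (hbB : M.Indep ((insert b B : Finset E) : Set E)) :
    ∃ O' ⊆ O, Disjoint (insert b B) O' ∧ M.Indep ((insert b B ∪ O' : Finset E) : Set E) ∧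
      (O \ O').card ≤ 1 := by
  obtain ⟨K, hK, hBK⟩ := hbB.subset_isBasis'_of_subset
    (X := ((insert b B ∪ O : Finset E) : Set E)) (by exact_mod_cast Finset.subset_union_left)
  lift K to Finset E using K.toFinite
  have hKX : K ⊆ insert b B ∪ O := by exact_mod_cast hK.subset
  have hBK' : insert b B ⊆ K := by exact_mod_cast hBK
  have hcard : (B ∪ O).card ≤ K.card := by
    have h1 := hind.encard_le_eRk_of_subset (X := ((insert b B ∪ O : Finset E) : Set E))
      (by exact_mod_cast Finset.union_subset_union_left (Finset.subset_insert b B))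
    rw [← hK.encard_eq_eRk, Set.encard_coe_eq_coe_finsetCard,
      Set.encard_coe_eq_coe_finsetCard] at h1
    exact_mod_cast h1
  have hsub : K \ insert b B ⊆ O := fun x hx => by
    rw [Finset.mem_sdiff] at hx
    exact (Finset.mem_union.1 (hKX hx.1)).resolve_left hx.2
  refine ⟨K \ insert b B, hsub, Finset.disjoint_sdiff, ?_, ?_⟩
  · rw [Finset.union_sdiff_of_subset hBK']
    exact hK.indep
  · rw [Finset.card_union_of_disjoint hBO] at hcard
    rw [Finset.card_sdiff_of_subset hsub, Finset.card_sdiff_of_subset hBK',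
      Finset.card_insert_of_notMem hb]
    omega

/-- The matroid polytope is down-closed. -/
theorem mem_matroidPolytope_of_le {M : Matroid E} {x z : E → ℝ} (hx : x ∈ matroidPolytope M)
    (hz : ∀ i, 0 ≤ z i) (hzx : ∀ i, z i ≤ x i) : z ∈ matroidPolytope M := by
  suffices h : ∀ T : Finset E, T.piecewise z x ∈ matroidPolytope M by
    simpa using h Finset.univ
  intro T
  induction T using Finset.induction_on with
  | empty => simpa using hx
  | insert a T ha ih =>
    rw [Finset.piecewise_insert]
    refine update_mem_matroidPolytope ih (hz a) ?_
    rw [Finset.piecewise_eq_of_notMem _ _ _ ha]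
    exact hzx a

end Matroids

/-! ### Failure probabilities and the concentration of the estimates -/

section Probability

/-- Union bound for a two-stage experiment. -/
theorem toOuterMeasure_bind_not_le {α β : Type*} {p : PMF α} {q : α → PMF β} {P : α → Prop}
    {Q : β → Prop} {a b : ℝ≥0∞} (hp : p.toOuterMeasure {x | ¬ P x} ≤ a)
    (hq : ∀ x, P x → (q x).toOuterMeasure {y | ¬ Q y} ≤ b) :
    (p.bind q).toOuterMeasure {y | ¬ Q y} ≤ a + b := by
  rw [PMF.toOuterMeasure_bind_apply]
  calc ∑' x, p x * (q x).toOuterMeasure {y | ¬ Q y}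
      ≤ ∑' x, (Set.indicator {x | ¬ P x} p x + p x * b) := by
        refine ENNReal.tsum_le_tsum fun x => ?_
        by_cases hx : P x
        · exact le_add_left (mul_le_mul_right (hq x hx) _)
        · rw [Set.indicator_of_mem (by exact hx)]
          refine le_add_right (mul_le_of_le_one_right' ?_)
          calc (q x).toOuterMeasure {y | ¬ Q y} ≤ (q x).toOuterMeasure Set.univ :=
                MeasureTheory.measure_mono (Set.subset_univ _)
            _ = 1 := ((q x).toOuterMeasure_apply_eq_one_iff _).2 (Set.subset_univ _)
    _ = p.toOuterMeasure {x | ¬ P x} + b := by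
        rw [ENNReal.tsum_add, ← PMF.toOuterMeasure_apply, ENNReal.tsum_mul_right, p.tsum_coe,
          one_mul]
    _ ≤ a + b := by gcongr

theorem toOuterMeasure_pure_not {α : Type*} {x : α} {P : α → Prop} (h : P x) :
    (PMF.pure x).toOuterMeasure {y | ¬ P y} = 0 := by
  rw [PMF.toOuterMeasure_pure_apply, if_neg (by simpa using h)]

theorem one_sub_le_toOuterMeasure {α : Type*} {p : PMF α} {P : α → Prop} {b : ℝ≥0∞}
    (h : p.toOuterMeasure {x | ¬ P x} ≤ b) : 1 - b ≤ p.toOuterMeasure {x | P x} := by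
  rw [tsub_le_iff_right]
  calc (1 : ℝ≥0∞) = p.toOuterMeasure Set.univ :=
        ((p.toOuterMeasure_apply_eq_one_iff _).2 (Set.subset_univ _)).symm
    _ ≤ p.toOuterMeasure ({x | P x} ∪ {x | ¬ P x}) :=
        MeasureTheory.measure_mono fun x _ => em (P x)
    _ ≤ p.toOuterMeasure {x | P x} + p.toOuterMeasure {x | ¬ P x} :=
        MeasureTheory.measure_union_le _ _
    _ ≤ _ := by gcongr

theorem length_of_mem_support_iidSamples {α : Type u} {p : PMF α} {m : ℕ} {l : List α}
    (h : l ∈ (iidSamples p m).support) : l.length = m := by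
  induction m generalizing l with
  | zero =>
    rw [iidSamples, PMF.mem_support_pure_iff] at h
    rw [h, List.length_nil]
  | succ m ih =>
    simp only [iidSamples, PMF.mem_support_bind_iff, PMF.mem_support_pure_iff] at h
    obtain ⟨x, -, l', hl', rfl⟩ := h
    rw [List.length_cons, ih hl']

/-- Chernoff's bound for the sum of `m` independent samples of `X`. -/
theorem iidSamples_toOuterMeasure_le {α : Type u} (p : PMF α) (X : α → ℝ) {K : ℝ≥0∞}
    (hK : ∑' x, p x * ENNReal.ofReal (Real.exp (X x)) ≤ K) (m : ℕ) (c : ℝ) :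
    (iidSamples p m).toOuterMeasure {l | c ≤ (l.map X).sum} ≤
      ENNReal.ofReal (Real.exp (-c)) * K ^ m := by
  induction m generalizing c with
  | zero =>
    rw [iidSamples, PMF.toOuterMeasure_pure_apply]
    split_ifs with h
    · have hc : c ≤ 0 := by simpa using h
      rw [pow_zero, mul_one, ENNReal.one_le_ofReal]
      exact Real.one_le_exp (neg_nonneg.2 hc)
    · exact zero_le
  | succ m ih =>
    rw [iidSamples, PMF.toOuterMeasure_bind_apply]
    calc ∑' x, p x * ((iidSamples p m).bind fun l => PMF.pure (x :: l)).toOuterMeasure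
            {l | c ≤ (l.map X).sum}
        ≤ ∑' x, ENNReal.ofReal (Real.exp (-c)) * K ^ m *
            (p x * ENNReal.ofReal (Real.exp (X x))) := by
          refine ENNReal.tsum_le_tsum fun x => ?_
          have h1 : ((iidSamples p m).bind fun l => PMF.pure (x :: l)) =
              (iidSamples p m).map (List.cons x) := rfl
          have h2 : List.cons x ⁻¹' {l | c ≤ (l.map X).sum} = {l | c - X x ≤ (l.map X).sum} := by
            ext l
            simp [add_comm]
          rw [h1, PMF.toOuterMeasure_map_apply, h2]
          refine (mul_le_mul_right (ih (c - X x)) _).trans_eq ?_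
          rw [neg_sub, sub_eq_add_neg, add_comm, Real.exp_add,
            ENNReal.ofReal_mul (Real.exp_nonneg _)]
          ring
      _ ≤ ENNReal.ofReal (Real.exp (-c)) * K ^ m * K := by
          rw [ENNReal.tsum_mul_left]
          gcongr
      _ = _ := by rw [pow_succ, mul_assoc]

variable {E : Type u} [Fintype E] [DecidableEq E]

theorem randomSet_iidSamples_toOuterMeasure_le (y : E → unitInterval) (X : Finset E → ℝ)
    {b : ℝ} (hb : b ≤ 1) (hX : ∀ S, |X S| ≤ b) (hmean : multilinearExt X (fun i => (y i : ℝ)) = 0)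
    (m : ℕ) (c : ℝ) :
    (iidSamples (randomSet y) m).toOuterMeasure {l | c ≤ (l.map X).sum} ≤
      ENNReal.ofReal (Real.exp (m * b ^ 2 - c)) := by
  have hy : ∀ i, (fun i => (y i : ℝ)) i ∈ Set.Icc (0 : ℝ) 1 := fun i => (y i).2
  have hmgf : ∑' S, randomSet y S * ENNReal.ofReal (Real.exp (X S)) ≤
      ENNReal.ofReal (Real.exp (b ^ 2)) := by
    rw [tsum_fintype]
    have h1 : ∀ S, randomSet y S * ENNReal.ofReal (Real.exp (X S)) =
        ENNReal.ofReal (Real.exp (X S) * weight (fun i => (y i : ℝ)) S) := fun S => by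
      rw [randomSet, PMF.ofFintype_apply, mul_comm, ENNReal.ofReal_mul (Real.exp_nonneg _)]
    simp only [h1]
    rw [← ENNReal.ofReal_sum_of_nonneg fun S _ => mul_nonneg (Real.exp_nonneg _)
      (weight_nonneg y S)]
    refine ENNReal.ofReal_le_ofReal ?_
    change multilinearExt (fun S => Real.exp (X S)) _ ≤ _
    have h2 : multilinearExt (fun S => Real.exp (X S) - X S) (fun i => (y i : ℝ)) ≤
        multilinearExt (fun _ => 1 + b ^ 2) (fun i => (y i : ℝ)) := by
      refine multilinearExt_mono hy fun S => ?_
      have h3 := (abs_le.1 (Real.abs_exp_sub_one_sub_id_le ((hX S).trans hb))).2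
      have h4 := sq_le_sq' (abs_le.1 (hX S)).1 (abs_le.1 (hX S)).2
      linarith
    rw [multilinearExt_sub (fun S => Real.exp (X S)) X, hmean, sub_zero,
      multilinearExt_const] at h2
    linarith [Real.add_one_le_exp (b ^ 2)]
  refine (iidSamples_toOuterMeasure_le (randomSet y) X hmgf m c).trans_eq ?_
  rw [← ENNReal.ofReal_pow (Real.exp_nonneg _), ← ENNReal.ofReal_mul (Real.exp_nonneg _),
    ← Real.exp_nat_mul, ← Real.exp_add]
  congr 2
  ring

/-- Hoeffding's inequality (with a constant that is not the best possible) for the estimate of the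
expected marginal value. -/
theorem estimate_toOuterMeasure_le (f : Finset E → ℝ) {m : ℕ} (hm : 0 < m)
    (y : E → unitInterval) (e : E) {R s : ℝ} (hR : 0 < R) (hs : 0 ≤ s) (hsR : s ≤ 2 * R)
    (hfR : ∀ S T, marginal f S e - marginal f T e ≤ R) :
    (estimate f m y e).toOuterMeasure
        {x | ¬ |x - multilinearExt (fun S => marginal f S e) (fun i => (y i : ℝ))| ≤ s} ≤
      2 * ENNReal.ofReal (Real.exp (-(m * s ^ 2 / (4 * R ^ 2)))) := by
  set D := multilinearExt (fun S => marginal f S e) (fun i => (y i : ℝ)) with hD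
  have hy : ∀ i, (fun i => (y i : ℝ)) i ∈ Set.Icc (0 : ℝ) 1 := fun i => (y i).2
  have hdev : ∀ S, |marginal f S e - D| ≤ R := fun S => by
    have h1 := multilinearExt_mono hy fun T => hfR S T
    have h2 := multilinearExt_mono hy fun T => hfR T S
    rw [multilinearExt_sub (fun _ => marginal f S e) (fun T => marginal f T e),
      multilinearExt_const, multilinearExt_const] at h1
    rw [multilinearExt_sub (fun T => marginal f T e) (fun _ => marginal f S e),
      multilinearExt_const, multilinearExt_const] at h2
    exact abs_le.2 ⟨by linarith, by linarith⟩
  -- Both tails are bounded with the exponential moment of parameter `s / (2 R ^ 2)`.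
  have htail : ∀ σ : ℝ, |σ| = 1 → (iidSamples (randomSet y) m).toOuterMeasure
      {l | m * s ^ 2 / (2 * R ^ 2) ≤
        (l.map fun S => σ * (s / (2 * R ^ 2)) * (marginal f S e - D)).sum} ≤
      ENNReal.ofReal (Real.exp (-(m * s ^ 2 / (4 * R ^ 2)))) := fun σ hσ => by
    refine (randomSet_iidSamples_toOuterMeasure_le y _ (b := s / (2 * R)) ?_ ?_ ?_ m _).trans_eq ?_
    · exact div_le_one_of_le₀ hsR (by positivity)
    · intro S
      rw [abs_mul, abs_mul, hσ, one_mul, abs_of_nonneg (by positivity)]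
      calc s / (2 * R ^ 2) * |marginal f S e - D| ≤ s / (2 * R ^ 2) * R := by
            gcongr
            exact hdev S
        _ = s / (2 * R) := by field_simp
    · have h1 : multilinearExt (fun S => σ * (s / (2 * R ^ 2)) * (marginal f S e - D))
          (fun i => (y i : ℝ)) = σ * (s / (2 * R ^ 2)) *
            multilinearExt (fun S => marginal f S e - D) (fun i => (y i : ℝ)) := by
        simp only [multilinearExt, Finset.mul_sum, mul_assoc]
      rw [h1, multilinearExt_sub (fun S => marginal f S e) (fun _ => D), multilinearExt_const,
        ← hD, sub_self, mul_zero]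
    · congr 2
      field_simp
      ring
  have hsum : ∀ (k : ℝ) (l : List (Finset E)), (l.map fun S => k * (marginal f S e - D)).sum =
      k * ((l.map fun S => marginal f S e).sum - l.length * D) := fun k l => by
    induction l with
    | nil => simp
    | cons S l ih =>
      simp only [List.map_cons, List.sum_cons, List.length_cons, ih]
      push_cast
      ring
  rw [estimate, PMF.toOuterMeasure_map_apply, two_mul]
  refine le_trans (le_trans (PMF.toOuterMeasure_mono _ ?_) (MeasureTheory.measure_union_le _ _))
    (add_le_add (htail 1 (by simp)) (htail (-1) (by simp)))
  rintro l ⟨hl, hsupp⟩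
  have hlen := length_of_mem_support_iidSamples hsupp
  have hm' : (0 : ℝ) < m := by exact_mod_cast hm
  simp only [Set.mem_preimage, Set.mem_ofPred_eq, not_le, lt_abs] at hl
  have hk : 0 ≤ s / (2 * R ^ 2) := by positivity
  have hms : m * s ^ 2 / (2 * R ^ 2) = s / (2 * R ^ 2) * (m * s) := by ring
  simp only [Set.mem_union, Set.mem_ofPred_eq, hsum, hlen, hms, one_mul]
  have hdiv : (l.map fun S => marginal f S e).sum =
      m * ((l.map fun S => marginal f S e).sum / m) := by field_simp
  rcases hl with hl | hl
  · left
    refine mul_le_mul_of_nonneg_left ?_ hk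
    nlinarith
  · right
    have h1 : m * s ≤ -((l.map fun S => marginal f S e).sum - m * D) := by nlinarith
    linarith [mul_le_mul_of_nonneg_left h1 hk]

end Probability

/-! ### Feasibility of the output -/

section Feasibility

variable {E : Type u} [Fintype E] [DecidableEq E]

theorem indep_of_mem_support_thresholdPass {M : Matroid E} {f : Finset E → ℝ} {m : ℕ}
    {δ : unitInterval} {y : E → unitInterval} {w : ℝ} {l : List E} {A B : Finset E}
    (hA : M.Indep (A : Set E)) (hB : B ∈ (thresholdPass M f m δ y w l A).support) :
    M.Indep (B : Set E) := by
  induction l generalizing A with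
  | nil =>
    rw [thresholdPass, PMF.mem_support_pure_iff] at hB
    rwa [hB]
  | cons e l ih =>
    rw [thresholdPass, PMF.mem_support_bind_iff] at hB
    obtain ⟨x, -, hx⟩ := hB
    split_ifs at hx with h
    · exact ih h.2 hx
    · exact ih hA hx

variable [Nonempty E]

theorem indep_of_mem_support_thresholdLoop {M : Matroid E} {f : Finset E → ℝ} {m : ℕ}
    {order : List E} {ε δ : unitInterval} {y : E → unitInterval} {k : ℕ} {B : Finset E}
    (hB : B ∈ (thresholdLoop M f m order ε δ y k).support) : M.Indep (B : Set E) := by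
  induction k generalizing B with
  | zero =>
    rw [thresholdLoop, PMF.mem_support_pure_iff] at hB
    simp [hB]
  | succ k ih =>
    rw [thresholdLoop, PMF.mem_support_bind_iff] at hB
    obtain ⟨A, hA, hB⟩ := hB
    exact indep_of_mem_support_thresholdPass (ih hA) hB

/-- Each step raises a coordinate by at most `ε`, and only on an independent set. -/
theorem exists_indep_of_mem_support_greedyLoop {M : Matroid E} {f : Finset E → ℝ} {m : ℕ}
    {order : List E} {ε : unitInterval} {k : ℕ} {y : E → unitInterval}
    (hy : y ∈ (greedyLoop M f m order ε k).support) :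
    ∃ S : ℕ → Finset E, (∀ j, M.Indep (S j : Set E)) ∧
      ∀ i, (y i : ℝ) ≤ ∑ j ∈ Finset.range k, (ε : ℝ) * if i ∈ S j then 1 else 0 := by
  induction k generalizing y with
  | zero =>
    rw [greedyLoop, PMF.mem_support_pure_iff] at hy
    exact ⟨fun _ => ∅, by simp, by simp [hy]⟩
  | succ k ih =>
    simp only [greedyLoop, PMF.mem_support_bind_iff, PMF.mem_support_pure_iff] at hy
    obtain ⟨z, hz, B, hB, rfl⟩ := hy
    obtain ⟨S, hS, hzS⟩ := ih hz
    refine ⟨Function.update S k B, fun j => ?_, fun i => ?_⟩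
    · by_cases hj : j = k
      · subst hj
        rw [Function.update_self]
        exact indep_of_mem_support_thresholdLoop hB
      · rw [Function.update_of_ne hj]
        exact hS j
    · rw [Finset.sum_range_succ, Function.update_self]
      have h1 : ∑ j ∈ Finset.range k, (ε : ℝ) * (if i ∈ Function.update S k B j then 1 else 0) =
          ∑ j ∈ Finset.range k, (ε : ℝ) * (if i ∈ S j then 1 else 0) :=
        Finset.sum_congr rfl fun j hj => by
          rw [Function.update_of_ne (Finset.mem_range.1 hj).ne]
      rw [h1]
      by_cases hi : i ∈ B
      · have h2 : 1 - (ε : ℝ) ≤ Real.exp (-(ε : ℝ)) := by linarith [Real.add_one_le_exp (-(ε : ℝ))]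
        have h3 : Real.exp (-(ε : ℝ)) ≤ 1 := Real.exp_le_one_iff.2 (neg_nonpos.2 ε.2.1)
        have h4 : (0 : ℝ) ≤ z i := (z i).2.1
        have h5 := hzS i
        simp only [stepPoint, hi, if_true, stepCoord]
        nlinarith
      · simpa [stepPoint, hi] using hzS i

theorem greedyLoop_support_subset_matroidPolytope {M : Matroid E} {f : Finset E → ℝ} {m : ℕ}
    {order : List E} {ε : unitInterval} {N : ℕ} (hN : (N : ℝ) * ε = 1) {y : E → unitInterval}
    (hy : y ∈ (greedyLoop M f m order ε N).support) :
    (fun i => (y i : ℝ)) ∈ matroidPolytope M := by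
  obtain ⟨S, hS, hyS⟩ := exists_indep_of_mem_support_greedyLoop hy
  refine mem_matroidPolytope_of_le
    (x := ∑ j ∈ Finset.range N, (ε : ℝ) • fun i => if i ∈ S j then 1 else 0) ?_
    (fun i => (y i).2.1) fun i => ?_
  · refine (convex_convexHull ℝ _).sum_mem (fun _ _ => ε.2.1) (by simpa using hN) fun j _ => ?_
    exact subset_convexHull ℝ _ ⟨S j, hS j, rfl⟩
  · simpa [Finset.sum_apply] using hyS i

end Feasibility

/-! ### Charging the optimal set to the elements chosen by Decreasing-Threshold -/

section Charging

variable {E : Type u} [DecidableEq E]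

/-- The point `y(B, δ)` as a real vector. -/
noncomputable def stepVec (δ : unitInterval) (y : E → unitInterval) (B : Finset E) : E → ℝ :=
  fun i => stepPoint δ y B i

theorem stepVec_mem (δ : unitInterval) (y : E → unitInterval) (B : Finset E) (i : E) :
    stepVec δ y B i ∈ Set.Icc (0 : ℝ) 1 :=
  coe_stepPoint_mem δ y B i

theorem stepVec_empty (δ : unitInterval) (y : E → unitInterval) :
    stepVec δ y ∅ = fun i => (y i : ℝ) := by
  funext i
  rw [stepVec, stepPoint_empty]

theorem IsSubmodular.marginal_le {f : Finset E → ℝ} (hf : IsSubmodular f) (hf0 : ∀ S, 0 ≤ f S)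
    (S : Finset E) (e : E) : marginal f S e ≤ f {e} := by
  have h := hf S {e}
  rw [Finset.union_comm, ← Finset.insert_eq] at h
  rw [marginal]
  linarith [hf0 (S ∩ {e})]

variable [Fintype E]

/-- The invariant of Decreasing-Threshold at threshold `w`, when all estimates are correct up to
`s`. The elements of `OPT \ O` have been charged to the elements of `B`, while `O` can still be
added to `B`; an element that can still be added has expected marginal value at most about `w`. -/
structure ThresholdInv (M : Matroid E) (f : Finset E → ℝ) (OPT : Finset E) (ε δ : unitInterval)
    (y : E → unitInterval) (s w : ℝ) (B : Finset E) : Prop where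
  indep : M.Indep (B : Set E)
  posGain_le : ∀ o, o ∉ B → M.Indep ((insert o B : Finset E) : Set E) →
    (1 - (ε : ℝ)) * posGain f (stepVec δ y B) o ≤ w + s
  charge : ∃ O ⊆ OPT, Disjoint B O ∧ M.Indep ((B ∪ O : Finset E) : Set E) ∧
    (1 - Real.exp (-(δ : ℝ))) *
        ((1 - (ε : ℝ)) * ∑ o ∈ OPT \ O, posGain f (stepVec δ y B) o - 2 * s * B.card) ≤
      multilinearExt f (stepVec δ y B) - multilinearExt f (stepVec δ y ∅)

variable {M : Matroid E} {f : Finset E → ℝ} {OPT : Finset E} {ε δ : unitInterval}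
  {y : E → unitInterval} {s w : ℝ} {B : Finset E}

theorem posGain_stepVec_antitone (hf : IsSubmodular f) (o : E) {A B : Finset E} (h : A ⊆ B) :
    posGain f (stepVec δ y B) o ≤ posGain f (stepVec δ y A) o :=
  hf.posGain_antitone o (stepVec_mem δ y A) (stepVec_mem δ y B) (stepPoint_mono δ y h)

/-- A chosen element `e` has expected marginal value at least `w - s`, which pays for itself and
for the element of `O` that it displaces, up to `2 s`. -/
theorem ThresholdInv.insert_element (hf : IsSubmodular f) (hs : 0 ≤ s) (hw : 0 ≤ w)
    (h : ThresholdInv M f OPT ε δ y s w B) {e : E} (he : e ∉ B)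
    (hind : M.Indep ((insert e B : Finset E) : Set E))
    (hgain : w - s ≤ multilinearExt (fun S => marginal f S e) (stepVec δ y B)) :
    ThresholdInv M f OPT ε δ y s w (insert e B) := by
  have hε : 0 ≤ 1 - (ε : ℝ) := sub_nonneg.2 ε.2.2
  have hanti : ∀ o, posGain f (stepVec δ y (insert e B)) o ≤ posGain f (stepVec δ y B) o :=
    fun o => posGain_stepVec_antitone hf o (Finset.subset_insert e B)
  obtain ⟨O, hO, hBO, hBOind, hcharge⟩ := h.charge
  obtain ⟨O', hO', hdisj, hind', hcard⟩ := exists_subset_indep_insert_union he hBO hBOind hind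
  refine ⟨hind, fun o ho hoB => ?_, O', hO'.trans hO, hdisj, hind', ?_⟩
  · rw [Finset.mem_insert, not_or] at ho
    refine (mul_le_mul_of_nonneg_left (hanti o) hε).trans (h.posGain_le o ho.2 (hoB.subset ?_))
    exact_mod_cast Finset.insert_subset_insert o (Finset.subset_insert e B)
  have hsplit : OPT \ O' = (OPT \ O) ∪ (O \ O') := by
    ext x
    have := @hO x
    have := @hO' x
    simp only [Finset.mem_union, Finset.mem_sdiff]
    tauto
  have hdisj2 : Disjoint (OPT \ O) (O \ O') :=
    Finset.sdiff_disjoint.mono_right Finset.sdiff_subset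
  have h1 : ∑ o ∈ OPT \ O', posGain f (stepVec δ y (insert e B)) o ≤
      ∑ o ∈ OPT \ O, posGain f (stepVec δ y B) o + ∑ o ∈ O \ O', posGain f (stepVec δ y B) o := by
    rw [hsplit, ← Finset.sum_union hdisj2]
    exact Finset.sum_le_sum fun o _ => hanti o
  have h2 : (1 - (ε : ℝ)) * ∑ o ∈ O \ O', posGain f (stepVec δ y B) o ≤ w + s := by
    rw [Finset.mul_sum]
    refine (Finset.sum_le_card_nsmul _ _ (w + s) fun o ho => ?_).trans ?_
    · have hoO := (Finset.mem_sdiff.1 ho).1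
      refine h.posGain_le o (Finset.disjoint_right.1 hBO hoO) (hBOind.subset ?_)
      exact_mod_cast Finset.insert_subset (Finset.mem_union_right _ hoO) Finset.subset_union_left
    · rw [nsmul_eq_mul]
      have hcard' : ((O \ O').card : ℝ) ≤ 1 := by exact_mod_cast hcard
      nlinarith
  have hF : multilinearExt f (stepVec δ y (insert e B)) = _ :=
    multilinearExt_stepPoint_insert f δ y he
  have hF' : multilinearExt f (stepVec δ y (insert e B)) =
      multilinearExt f (stepVec δ y B) + (1 - Real.exp (-(δ : ℝ))) *
        multilinearExt (fun S => marginal f S e) (stepVec δ y B) := hF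
  have hq : 0 ≤ 1 - Real.exp (-(δ : ℝ)) :=
    sub_nonneg.2 (Real.exp_le_one_iff.2 (neg_nonpos.2 δ.2.1))
  have h3 := mul_le_mul_of_nonneg_left h1 hε
  rw [Finset.card_insert_of_notMem he, hF']
  push_cast
  have h4 : (1 - (ε : ℝ)) * ∑ o ∈ OPT \ O', posGain f (stepVec δ y (insert e B)) o -
      2 * s * (B.card + 1) ≤ ((1 - (ε : ℝ)) * ∑ o ∈ OPT \ O, posGain f (stepVec δ y B) o -
        2 * s * B.card) + multilinearExt (fun S => marginal f S e) (stepVec δ y B) := by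
    linarith
  have h5 := mul_le_mul_of_nonneg_left h4 hq
  rw [mul_add] at h5
  linarith

/-- A pass keeps the invariant, and afterwards every element that can still be added has expected
marginal value at most `w + s`, unless one of its estimates fails. -/
theorem thresholdPass_toOuterMeasure_le (hf : IsSubmodular f) {m : ℕ} (hs : 0 ≤ s) (hw : 0 ≤ w)
    {β : ℝ≥0∞} (hest : ∀ (z : E → unitInterval) (e : E), (estimate f m z e).toOuterMeasure
      {x | ¬ |x - multilinearExt (fun S => marginal f S e) (fun i => (z i : ℝ))| ≤ s} ≤ β)
    (l : List E) (B : Finset E) (hB : ThresholdInv M f OPT ε δ y s w B)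
    (hl : ∀ o, o ∉ B → o ∉ l → M.Indep ((insert o B : Finset E) : Set E) →
      posGain f (stepVec δ y B) o ≤ w + s) :
    (thresholdPass M f m δ y w l B).toOuterMeasure {A | ¬ (ThresholdInv M f OPT ε δ y s w A ∧
      ∀ o, o ∉ A → M.Indep ((insert o A : Finset E) : Set E) →
        posGain f (stepVec δ y A) o ≤ w + s)} ≤ l.length * β := by
  induction l generalizing B with
  | nil =>
    rw [thresholdPass, toOuterMeasure_pure_not ⟨hB, fun o ho => hl o ho (by simp)⟩]
    exact zero_le
  | cons e l ih =>
    rw [thresholdPass, List.length_cons, Nat.cast_succ, add_mul, one_mul, add_comm (_ * β)]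
    refine toOuterMeasure_bind_not_le (hest (stepPoint δ y B) e) fun x hx => ?_
    change |x - multilinearExt (fun S => marginal f S e) (stepVec δ y B)| ≤ s at hx
    rw [abs_le] at hx
    by_cases heB : e ∈ B
    · rw [Finset.insert_eq_of_mem heB, ite_self]
      refine ih B hB fun o ho hol => hl o ho ?_
      rw [List.mem_cons, not_or]
      exact ⟨fun h => ho (h ▸ heB), hol⟩
    split_ifs with h
    · refine ih _ (hB.insert_element hf hs hw heB h.2 (by linarith [h.1])) fun o ho hol hoB => ?_
      rw [Finset.mem_insert, not_or] at ho
      refine (posGain_stepVec_antitone hf o (Finset.subset_insert e B)).trans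
        (hl o ho.2 ?_ (hoB.subset ?_))
      · rw [List.mem_cons, not_or]
        exact ⟨ho.1, hol⟩
      · exact_mod_cast Finset.insert_subset_insert o (Finset.subset_insert e B)
    · refine ih B hB fun o ho hol hoB => ?_
      by_cases hoe : o = e
      · subst hoe
        have hxw : x < w := lt_of_not_ge fun hwx => h ⟨hwx, hoB⟩
        exact max_le (by linarith) (by linarith)
      · exact hl o ho (by rw [List.mem_cons, not_or]; exact ⟨hoe, hol⟩) hoB

variable [Nonempty E]

theorem IsSubmodular.marginal_le_dUpper (hf : IsSubmodular f) (hf0 : ∀ S, 0 ≤ f S)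
    (S : Finset E) (e : E) : marginal f S e ≤ dUpper f :=
  (hf.marginal_le hf0 S e).trans (Finset.le_sup' (fun i : E => f {i}) (Finset.mem_univ e))

theorem neg_marginal_le_dLower (f : Finset E → ℝ) (S : Finset E) (e : E) :
    -marginal f S e ≤ dLower f :=
  Finset.le_sup' (fun p : Finset E × E => -marginal f p.1 p.2) (Finset.mem_univ (S, e))

theorem dLower_nonneg (f : Finset E → ℝ) : 0 ≤ dLower f := by
  obtain ⟨e⟩ := ‹Nonempty E›
  simpa [marginal] using neg_marginal_le_dLower f Finset.univ e

theorem thresholdLoop_toOuterMeasure_le (hf : IsSubmodular f) (hf0 : ∀ S, 0 ≤ f S)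
    (hd : 0 ≤ dUpper f) (hOPT : M.Indep (OPT : Set E)) {m : ℕ} (hs : 0 ≤ s) {β : ℝ≥0∞}
    (hest : ∀ (z : E → unitInterval) (e : E), (estimate f m z e).toOuterMeasure
      {x | ¬ |x - multilinearExt (fun S => marginal f S e) (fun i => (z i : ℝ))| ≤ s} ≤ β)
    {order : List E} (horder : ∀ e, e ∈ order) (k : ℕ) :
    (thresholdLoop M f m order ε δ y k).toOuterMeasure
      {B | ¬ ThresholdInv M f OPT ε δ y s (dUpper f * (1 - (ε : ℝ)) ^ k) B} ≤
      k * (order.length * β) := by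
  have hε : 0 ≤ 1 - (ε : ℝ) := sub_nonneg.2 ε.2.2
  have hε1 : 1 - (ε : ℝ) ≤ 1 := sub_le_self _ ε.2.1
  induction k with
  | zero =>
    rw [thresholdLoop, toOuterMeasure_pure_not]
    · exact zero_le
    refine ⟨by simp, fun o _ _ => ?_, OPT, subset_rfl, Finset.disjoint_empty_left _,
      by simpa using hOPT, by simp⟩
    have h1 : posGain f (stepVec δ y ∅) o ≤ dUpper f := by
      refine max_le hd ?_
      rw [← multilinearExt_const (dUpper f) (stepVec δ y ∅)]
      exact multilinearExt_mono (stepVec_mem δ y ∅) fun S => hf.marginal_le_dUpper hf0 S o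
    have h2 := mul_le_of_le_one_left (posGain_nonneg f (stepVec δ y ∅) o) hε1
    rw [pow_zero]
    linarith
  | succ k ih =>
    rw [thresholdLoop, Nat.cast_succ, add_mul, one_mul]
    refine toOuterMeasure_bind_not_le ih fun B hB => ?_
    refine le_trans (MeasureTheory.measure_mono fun A hA => ?_)
      (thresholdPass_toOuterMeasure_le hf hs (mul_nonneg hd (pow_nonneg hε k)) hest order B hB
        fun o _ ho => absurd (horder o) ho)
    refine fun h => hA ⟨h.1.indep, fun o ho hoA => ?_, h.1.charge⟩
    have h1 := mul_le_mul_of_nonneg_left (h.2 o ho hoA) hε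
    have h2 := mul_le_of_le_one_left hs hε1
    rw [pow_succ]
    linarith

/-- Unless an estimate fails, the gain of Decreasing-Threshold is comparable to the total expected
marginal value of `OPT` at the new point: what is left of `OPT` uncharged has values below the last
threshold, and `|O| + |B| ≤ r` bounds the errors. -/
theorem decreasingThreshold_toOuterMeasure_le (hf : IsSubmodular f) (hf0 : ∀ S, 0 ≤ f S)
    (hd : 0 ≤ dUpper f) (hOPT : M.Indep (OPT : Set E)) (hr : 0 < rk M) {m : ℕ} (hs : 0 ≤ s)
    {β : ℝ≥0∞}
    (hest : ∀ (z : E → unitInterval) (e : E), (estimate f m z e).toOuterMeasure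
      {x | ¬ |x - multilinearExt (fun S => marginal f S e) (fun i => (z i : ℝ))| ≤ s} ≤ β)
    {order : List E} (horder : ∀ e, e ∈ order)
    (hne : {k : ℕ | dUpper f * (1 - (ε : ℝ)) ^ k <
      ε * (dUpper f / rk M) * (1 - yBar δ y)}.Nonempty) :
    (decreasingThreshold M f m order ε δ y).toOuterMeasure
      {B | ¬ ((1 - Real.exp (-(δ : ℝ))) *
        ((1 - (ε : ℝ)) * ∑ o ∈ OPT, posGain f (stepVec δ y B) o -
          (ε * dUpper f + 2 * s * rk M)) ≤
        multilinearExt f (stepVec δ y B) - multilinearExt f (fun i => (y i : ℝ)))} ≤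
      numPasses M f ε δ y * (order.length * β) := by
  have hε : 0 ≤ 1 - (ε : ℝ) := sub_nonneg.2 ε.2.2
  have hr' : (0 : ℝ) < rk M := by exact_mod_cast hr
  refine le_trans (MeasureTheory.measure_mono fun B hB => ?_)
    (thresholdLoop_toOuterMeasure_le hf hf0 hd hOPT hs hest horder _)
  refine fun h => hB ?_
  have hK : dUpper f * (1 - (ε : ℝ)) ^ numPasses M f ε δ y <
      ε * (dUpper f / rk M) * (1 - yBar δ y) := Nat.sInf_mem hne
  set w := dUpper f * (1 - (ε : ℝ)) ^ numPasses M f ε δ y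
  have hyBar : 0 ≤ yBar δ y := by
    obtain ⟨e⟩ := ‹Nonempty E›
    exact (stepCoord δ (y e)).2.1.trans
      (Finset.le_sup' (fun i : E => (stepCoord δ (y i) : ℝ)) (Finset.mem_univ e))
  have hw : rk M * w ≤ ε * dUpper f := by
    have h1 : w ≤ ε * (dUpper f / rk M) := hK.le.trans
      (mul_le_of_le_one_right (mul_nonneg ε.2.1 (div_nonneg hd hr'.le)) (by linarith))
    calc rk M * w ≤ rk M * (ε * (dUpper f / rk M)) := mul_le_mul_of_nonneg_left h1 hr'.le
      _ = ε * dUpper f := by field_simp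
  have hw0 : 0 ≤ w := mul_nonneg hd (pow_nonneg hε _)
  obtain ⟨O, hO, hBO, hBOind, hcharge⟩ := h.charge
  rw [stepVec_empty] at hcharge
  refine le_trans (mul_le_mul_of_nonneg_left ?_
    (sub_nonneg.2 (Real.exp_le_one_iff.2 (neg_nonpos.2 δ.2.1)))) hcharge
  have hcard : (B.card : ℝ) + O.card ≤ rk M := by
    have h1 := card_le_rk hBOind
    rw [Finset.card_union_of_disjoint hBO] at h1
    exact_mod_cast h1
  have h2 : (1 - (ε : ℝ)) * ∑ o ∈ O, posGain f (stepVec δ y B) o ≤ O.card * (w + s) := by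
    rw [Finset.mul_sum, ← nsmul_eq_mul]
    refine Finset.sum_le_card_nsmul _ _ (w + s) fun o ho => ?_
    refine h.posGain_le o (Finset.disjoint_right.1 hBO ho) (hBOind.subset ?_)
    exact_mod_cast Finset.insert_subset (Finset.mem_union_right _ ho) Finset.subset_union_left
  rw [← Finset.sum_sdiff hO, mul_add]
  have hB0 : (0 : ℝ) ≤ B.card := Nat.cast_nonneg _
  have hO0 : (0 : ℝ) ≤ O.card := Nat.cast_nonneg _
  have h3 : O.card * w ≤ rk M * w := mul_le_mul_of_nonneg_right (by linarith) hw0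
  have h4 := mul_le_mul_of_nonneg_right hcard hs
  have h5 := mul_nonneg hO0 hs
  linarith

end Charging

/-! ### The main loop -/

section MainLoop

variable {E : Type u} {M : Matroid E} {f : Finset E → ℝ} {OPT : Finset E} {ε : unitInterval}
  {y : E → unitInterval} {B : Finset E}

theorem one_sub_stepPoint_ge [DecidableEq E] {t : ℝ} (hy : ∀ i, Real.exp (-t) ≤ 1 - (y i : ℝ))
    (i : E) : Real.exp (-(t + ε)) ≤ 1 - (stepPoint ε y B i : ℝ) := by
  by_cases hi : i ∈ B
  · have h1 := mul_le_mul_of_nonneg_left (hy i) (Real.exp_nonneg (-(ε : ℝ)))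
    rw [← Real.exp_add, ← neg_add, add_comm (ε : ℝ)] at h1
    simp only [stepPoint, hi, if_true, stepCoord]
    linarith
  · simp only [stepPoint, hi, if_false]
    refine le_trans (Real.exp_le_exp.2 ?_) (hy i)
    linarith [ε.2.1]

variable [Fintype E]

theorem one_sub_yBar_ge [Nonempty E] {t : ℝ} (hy : ∀ i, Real.exp (-t) ≤ 1 - (y i : ℝ)) :
    Real.exp (-(t + ε)) ≤ 1 - yBar ε y := by
  have h : yBar ε y ≤ 1 - Real.exp (-(t + ε)) := by
    refine Finset.sup'_le _ _ fun i _ => ?_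
    have h1 := mul_le_mul_of_nonneg_left (hy i) (Real.exp_nonneg (-(ε : ℝ)))
    rw [← Real.exp_add, ← neg_add, add_comm (ε : ℝ)] at h1
    simp only [stepCoord]
    linarith
  linarith

/-- After `2 N² r` passes the threshold is below the stopping value. -/
theorem threshold_lt_stopping [Nonempty E] (hd : 0 < dUpper f) (hr : 0 < rk M) {N : ℕ}
    (hN : (N : ℝ) * ε = 1)
    (hy : Real.exp (-1) ≤ 1 - yBar ε y) :
    dUpper f * (1 - (ε : ℝ)) ^ (2 * N ^ 2 * rk M) <
      ε * (dUpper f / rk M) * (1 - yBar ε y) := by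
  have hε : 0 ≤ 1 - (ε : ℝ) := sub_nonneg.2 ε.2.2
  have hr' : (0 : ℝ) < rk M := by exact_mod_cast hr
  have hN0 : (0 : ℝ) < N := by
    rcases (Nat.cast_nonneg N : (0 : ℝ) ≤ N).eq_or_lt with h | h
    · rw [← h, zero_mul] at hN
      exact absurd hN zero_ne_one
    · exact h
  have hε0 : 0 < (ε : ℝ) := by
    by_contra h
    nlinarith
  have hNr : 0 < N * (rk M : ℝ) := mul_pos hN0 hr'
  have h1 : (1 - (ε : ℝ)) ^ (2 * N ^ 2 * rk M) ≤ Real.exp (-(2 * (N * rk M))) := by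
    calc (1 - (ε : ℝ)) ^ (2 * N ^ 2 * rk M) ≤ Real.exp (-(ε : ℝ)) ^ (2 * N ^ 2 * rk M) :=
          pow_le_pow_left₀ hε (by linarith [Real.add_one_le_exp (-(ε : ℝ))]) _
      _ = Real.exp (-(2 * (N * rk M))) := by
          rw [← Real.exp_nat_mul]
          congr 1
          push_cast
          linear_combination (-2 * (N : ℝ) * rk M) * hN
  -- `exp (- 2 x) < exp (- 1) / x` for `x = N r`, because `x < exp x` and `x ≥ 1`.
  have hNr1 : 1 ≤ N * (rk M : ℝ) := by
    have h2 : (1 : ℝ) ≤ N := by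
      have : 0 < N := by exact_mod_cast hN0
      exact_mod_cast this
    have h3 : (1 : ℝ) ≤ rk M := by exact_mod_cast hr
    nlinarith
  have h2 : N * (rk M : ℝ) < Real.exp (N * rk M) := by linarith [Real.add_one_le_exp (N * rk M : ℝ)]
  have h3 : Real.exp (-(2 * (N * rk M))) < (N * (rk M : ℝ))⁻¹ * Real.exp (-1) := by
    have h4 : Real.exp (-(2 * (N * rk M : ℝ))) =
        (Real.exp (N * rk M))⁻¹ * Real.exp (-(N * rk M)) := by
      rw [← Real.exp_neg, ← Real.exp_add]
      congr 1
      ring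
    rw [h4]
    exact mul_lt_mul (inv_strictAnti₀ hNr h2) (Real.exp_le_exp.2 (by linarith))
      (Real.exp_pos _) (inv_nonneg.2 hNr.le)
  have hεN : (ε : ℝ) = (N : ℝ)⁻¹ := eq_inv_of_mul_eq_one_right hN
  calc dUpper f * (1 - (ε : ℝ)) ^ (2 * N ^ 2 * rk M)
      < dUpper f * ((N * (rk M : ℝ))⁻¹ * Real.exp (-1)) :=
        mul_lt_mul_of_pos_left (h1.trans_lt h3) hd
    _ = ε * (dUpper f / rk M) * Real.exp (-1) := by
        rw [hεN, mul_inv]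
        ring
    _ ≤ ε * (dUpper f / rk M) * (1 - yBar ε y) := by gcongr

variable [DecidableEq E]

/-- The gain of one step of the main loop, in terms of the value after the step. -/
theorem sub_le_sum_posGain_stepVec (hf : IsSubmodular f) (hf0 : ∀ S, 0 ≤ f S) (hε : 0 < (ε : ℝ))
    {t : ℝ} (ht : 0 ≤ t) (hy : ∀ i, Real.exp (-t) ≤ 1 - (y i : ℝ)) :
    Real.exp (-(t + ε)) * f OPT - multilinearExt f (stepVec ε y B) ≤
      ∑ o ∈ OPT, posGain f (stepVec ε y B) o := by
  refine le_trans (sub_le_sub_right ?_ _) (hf.sub_le_sum_posGain OPT (stepVec_mem ε y B))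
  have h1 : Real.exp (-(t + ε)) < 1 := Real.exp_lt_one_iff.2 (by linarith)
  have h := hf.le_multilinearExt_union hf0 OPT (p := 1 - Real.exp (-(t + ε))) (by linarith)
    (by linarith [Real.exp_pos (-(t + ε))]) (y := stepVec ε y B)
    (fun i => (stepVec_mem ε y B i).1) (fun i => by
      have := one_sub_stepPoint_ge (ε := ε) (B := B) hy i
      rw [stepVec]
      linarith)
  rwa [sub_sub_cancel] at h

/-- The invariant of the main loop after `k` steps. In the idealized process `e^t F(y(t))` grows at
rate `f OPT`; the second summand collects the errors of the estimates and of the last threshold. -/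
def LoopInv (f : Finset E → ℝ) (OPT : Finset E) (ε : unitInterval) (k : ℕ)
    (y : E → unitInterval) : Prop :=
  (∀ i, Real.exp (-(k * ε)) ≤ 1 - (y i : ℝ)) ∧
  f OPT * (k * ((1 - Real.exp (-(ε : ℝ))) * (1 - ε) * Real.exp (-(ε : ℝ))) -
      3 / 2 * ε * ((1 - Real.exp (-(ε : ℝ))) * ∑ j ∈ Finset.range k, Real.exp (j * ε))) ≤
    Real.exp (k * ε) * multilinearExt f fun i => (y i : ℝ)

theorem LoopInv.step (hf : IsSubmodular f) (hf0 : ∀ S, 0 ≤ f S) (hε : 0 < (ε : ℝ)) {k : ℕ}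
    (h : LoopInv f OPT ε k y)
    (hB : (1 - Real.exp (-(ε : ℝ))) *
        ((1 - (ε : ℝ)) * ∑ o ∈ OPT, posGain f (stepVec ε y B) o - 3 / 2 * ε * f OPT) ≤
        multilinearExt f (stepVec ε y B) - multilinearExt f (fun i => (y i : ℝ))) :
    LoopInv f OPT ε (k + 1) (stepPoint ε y B) := by
  have hk : ((k + 1 : ℕ) : ℝ) * ε = k * ε + ε := by
    push_cast
    ring
  refine ⟨fun i => ?_, ?_⟩
  · rw [hk]
    exact one_sub_stepPoint_ge h.1 i
  change _ ≤ _ * multilinearExt f (stepVec ε y B)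
  have hgain := sub_le_sum_posGain_stepVec (OPT := OPT) (B := B) hf hf0 hε
    (mul_nonneg (Nat.cast_nonneg k) hε.le) h.1
  have h2 := h.2
  have hF' : 0 ≤ multilinearExt f (stepVec ε y B) :=
    multilinearExt_nonneg (stepVec_mem ε y B) hf0
  rw [hk, Finset.sum_range_succ]
  push_cast
  have hε1 : 0 ≤ 1 - (ε : ℝ) := sub_nonneg.2 ε.2.2
  have hH : Real.exp (-(k * ε + ε)) * Real.exp (k * ε) = Real.exp (-(ε : ℝ)) := by
    rw [← Real.exp_add]
    congr 1
    ring
  have hG : Real.exp (k * ε) = Real.exp (-(ε : ℝ)) * Real.exp (k * ε + ε) := by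
    rw [← Real.exp_add]
    congr 1
    ring
  have hx1 : Real.exp (-(ε : ℝ)) ≤ 1 := Real.exp_le_one_iff.2 (neg_nonpos.2 hε.le)
  have hx0 := Real.exp_pos (-(ε : ℝ))
  have hG0 := Real.exp_pos (k * ε : ℝ)
  have hH0 := Real.exp_pos (k * ε + ε : ℝ)
  set x := Real.exp (-(ε : ℝ))
  set G := Real.exp (k * ε : ℝ)
  set H := Real.exp (k * ε + ε : ℝ)
  set F' := multilinearExt f (stepVec ε y B)
  set F := multilinearExt f (fun i => (y i : ℝ))
  set P := ∑ o ∈ OPT, posGain f (stepVec ε y B) o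
  set z := Real.exp (-(k * ε + ε : ℝ))
  have hq : 0 ≤ 1 - x := by linarith
  have h3 : (1 - x) * ((1 - ε) * (z * f OPT - F') - 3 / 2 * ε * f OPT) ≤ F' - F :=
    le_trans (mul_le_mul_of_nonneg_left
      (sub_le_sub_right (mul_le_mul_of_nonneg_left hgain hε1) _) hq) hB
  have h4 := mul_le_mul_of_nonneg_left h3 hG0.le
  have h5 : G * ((1 - x) * ((1 - ε) * (z * f OPT - F') - 3 / 2 * ε * f OPT)) =
      (1 - x) * (1 - ε) * f OPT * x - G * ((1 - x) * (1 - ε)) * F' -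
        G * (1 - x) * (3 / 2 * ε * f OPT) := by
    linear_combination ((1 - x) * (1 - ε) * f OPT) * hH
  -- `e^{kε} (1 + q (1 - ε)) ≤ e^{(k+1)ε} (1 - q²)` with `q = 1 - e^{-ε}`.
  have h6 : G * (1 + (1 - x) * (1 - ε)) ≤ H := by
    have h7 : G * (1 + (1 - x) * (1 - ε)) = H * (1 - (1 - x) ^ 2) - G * ((1 - x) * ε) := by
      rw [hG]
      ring
    have h8 := mul_nonneg hG0.le (mul_nonneg hq hε.le)
    have h9 := mul_nonneg hH0.le (sq_nonneg (1 - x))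
    linarith
  have h7 := mul_le_mul_of_nonneg_right h6 hF'
  linarith

/-- The main loop keeps its invariant unless one of the estimates fails: a pass makes one estimate
for each element of `order`, and a step has at most `2 N² r` passes. -/
theorem greedyLoop_toOuterMeasure_le [Nonempty E] (hf : IsSubmodular f)
    (hf0 : ∀ S, 0 ≤ f S) (hd : 0 < dUpper f) (hdOPT : dUpper f ≤ f OPT)
    (hOPT : M.Indep (OPT : Set E)) (hr : 0 < rk M) {N : ℕ} (hN : (N : ℝ) * ε = 1) (hε : 0 < (ε : ℝ))
    {m : ℕ} {β : ℝ≥0∞}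
    (hest : ∀ (z : E → unitInterval) (e : E), (estimate f m z e).toOuterMeasure
      {x | ¬ |x - multilinearExt (fun S => marginal f S e) (fun i => (z i : ℝ))| ≤
        ε * dUpper f / (4 * rk M)} ≤ β)
    {order : List E} (horder : ∀ e, e ∈ order) {k : ℕ} (hk : k ≤ N) :
    (greedyLoop M f m order ε k).toOuterMeasure {y | ¬ LoopInv f OPT ε k y} ≤
      k * ((2 * N ^ 2 * rk M : ℕ) * (order.length * β)) := by
  have hr' : (0 : ℝ) < rk M := by exact_mod_cast hr
  induction k with
  | zero =>
    rw [greedyLoop, toOuterMeasure_pure_not]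
    · exact zero_le
    refine ⟨fun i => by simp, ?_⟩
    have h : 0 ≤ multilinearExt f fun i => ((fun _ => 0 : E → unitInterval) i : ℝ) :=
      multilinearExt_nonneg (fun i => (0 : unitInterval).2) hf0
    simpa using h
  | succ k ih =>
    rw [greedyLoop, Nat.cast_succ, add_mul, one_mul]
    refine toOuterMeasure_bind_not_le (ih (by omega)) fun y hy => ?_
    have hkε : (k : ℝ) * ε + ε ≤ 1 := by
      have h1 : ((k : ℝ) + 1) ≤ N := by exact_mod_cast hk
      nlinarith
    have hlt := threshold_lt_stopping hd hr hN
      ((Real.exp_le_exp.2 (neg_le_neg hkε)).trans (one_sub_yBar_ge hy.1))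
    have hpasses : numPasses M f ε ε y ≤ 2 * N ^ 2 * rk M := Nat.sInf_le hlt
    rw [← add_zero (((2 * N ^ 2 * rk M : ℕ) : ℝ≥0∞) * (order.length * β))]
    refine toOuterMeasure_bind_not_le ((decreasingThreshold_toOuterMeasure_le hf hf0 hd.le hOPT hr
      (by positivity) hest horder ⟨_, hlt⟩).trans (by gcongr)) fun B hB => ?_
    rw [toOuterMeasure_pure_not]
    refine hy.step hf hf0 hε (le_trans ?_ hB)
    refine mul_le_mul_of_nonneg_left (sub_le_sub_left ?_ _)
      (sub_nonneg.2 (Real.exp_le_one_iff.2 (neg_nonpos.2 hε.le)))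
    have h1 : 2 * (ε * dUpper f / (4 * rk M)) * rk M = ε * dUpper f / 2 := by
      field_simp
      ring
    have h2 := mul_le_mul_of_nonneg_left hdOPT hε.le
    rw [h1]
    linarith

/-- As `N ε = 1`, the invariant after `N` steps gives `e F(y) ≥ (1 - 5ε/2 - 3ε(e - 1)/2) f OPT`, and
`5/2 + 3(e - 1)/2 ≤ 2e`. -/
theorem LoopInv.le_multilinearExt (hOPT : 0 ≤ f OPT) {N : ℕ} (hN : (N : ℝ) * ε = 1)
    (hε : 0 < (ε : ℝ)) (h : LoopInv f OPT ε N y) :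
    (1 / Real.exp 1 - 2 * (ε : ℝ)) * f OPT ≤ multilinearExt f fun i => (y i : ℝ) := by
  have h2 := h.2
  rw [hN] at h2
  have hε1 : (ε : ℝ) ≤ 1 := ε.2.2
  have he : 2 < Real.exp 1 := by linarith [Real.exp_one_gt_d9]
  have hx0 := Real.exp_pos (-(ε : ℝ))
  have hxe : Real.exp (-(ε : ℝ)) * Real.exp ε = 1 := by
    rw [← Real.exp_add, neg_add_cancel, Real.exp_zero]
  have hx1 : Real.exp (-(ε : ℝ)) ≤ 1 := Real.exp_le_one_iff.2 (neg_nonpos.2 hε.le)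
  have hxl : 1 - (ε : ℝ) ≤ Real.exp (-(ε : ℝ)) := by
    linarith [Real.add_one_le_exp (-(ε : ℝ))]
  have hxu : Real.exp (-(ε : ℝ)) ≤ 1 - ε + ε ^ 2 / 2 := by
    have h3 := Real.quadratic_le_exp_of_nonneg hε.le
    have h4 : 0 ≤ 1 - (ε : ℝ) + ε ^ 2 / 2 := by nlinarith
    have h5 := mul_le_mul_of_nonneg_left h3 h4
    have h6 : (1 - (ε : ℝ) + ε ^ 2 / 2) * (1 + ε + ε ^ 2 / 2) = 1 + ε ^ 4 / 4 := by ring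
    have h7 : (0 : ℝ) ≤ ε ^ 4 := by positivity
    have h8 : Real.exp (-(ε : ℝ)) * Real.exp ε ≤ (1 - ε + ε ^ 2 / 2) * Real.exp ε := by
      rw [hxe]
      linarith
    exact le_of_mul_le_mul_right h8 (Real.exp_pos _)
  have hgeom : (1 - Real.exp (-(ε : ℝ))) * ∑ j ∈ Finset.range N, Real.exp (j * ε) ≤
      Real.exp 1 - 1 := by
    have h3 : (∑ j ∈ Finset.range N, Real.exp (j * ε)) * (Real.exp ε - 1) = Real.exp 1 - 1 := by
      simp only [Real.exp_nat_mul]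
      rw [geom_sum_mul, ← Real.exp_nat_mul, hN]
    have h4 : (1 - Real.exp (-(ε : ℝ))) = Real.exp (-(ε : ℝ)) * (Real.exp ε - 1) := by
      linear_combination -hxe
    rw [h4, mul_assoc, mul_comm (Real.exp ε - 1), h3]
    exact mul_le_of_le_one_left (by linarith) hx1
  have hNq : 1 - (ε : ℝ) / 2 ≤ N * (1 - Real.exp (-(ε : ℝ))) := by
    have h3 : (N : ℝ) * (ε - ε ^ 2 / 2) ≤ N * (1 - Real.exp (-(ε : ℝ))) :=
      mul_le_mul_of_nonneg_left (by linarith) (Nat.cast_nonneg N)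
    have h4 : (N : ℝ) * (ε - ε ^ 2 / 2) = 1 - ε / 2 := by linear_combination (1 - ε / 2 : ℝ) * hN
    linarith
  have hmain : 1 - 5 / 2 * (ε : ℝ) ≤ N * ((1 - Real.exp (-(ε : ℝ))) * (1 - ε) *
      Real.exp (-(ε : ℝ))) := by
    have h3 : (1 - (ε : ℝ) / 2) * ((1 - ε) * (1 - ε)) ≤
        (N * (1 - Real.exp (-(ε : ℝ)))) * ((1 - ε) * Real.exp (-(ε : ℝ))) :=
      mul_le_mul hNq (mul_le_mul_of_nonneg_left hxl (by linarith)) (by nlinarith)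
        (le_trans (by linarith) hNq)
    nlinarith
  have h3 : f OPT * (1 - 2 * Real.exp 1 * ε) ≤
      Real.exp 1 * multilinearExt f fun i => (y i : ℝ) := by
    refine le_trans (mul_le_mul_of_nonneg_left ?_ hOPT) h2
    nlinarith
  have h4 : Real.exp 1 * ((1 / Real.exp 1 - 2 * (ε : ℝ)) * f OPT) =
      f OPT * (1 - 2 * Real.exp 1 * ε) := by
    field_simp
  exact le_of_mul_le_mul_left (h4.trans_le h3) (Real.exp_pos 1)

end MainLoop

end AccelGreedy

theorem mainTheorem1 (c : ℝ) (hc : 0 < c) :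
    ∃ C : ℝ, 0 < C ∧
      ∀ (E : Type u) [Fintype E] [DecidableEq E] [Nonempty E]
        (M : Matroid E) (f : Finset E → ℝ) (OPT : Finset E)
        (order : List E) (ε : unitInterval) (m : ℕ),
        M.E = Set.univ →
        0 < AccelGreedy.rk M →
        (∀ S, 0 ≤ f S) →
        AccelGreedy.IsSubmodular f →
        0 < AccelGreedy.dUpper f →
        M.Indep (OPT : Set E) →
        (∀ S : Finset E, M.Indep (S : Set E) → f S ≤ f OPT) →
        (∀ e : E, ¬ M.Indep {e} → f {e} ≤ f OPT) →
        order.Nodup →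
        (∀ e : E, e ∈ order) →
        (∃ N : ℕ, 0 < N ∧ (ε : ℝ) = 1 / N) →
        0 < m →
        C * ((AccelGreedy.rk M : ℝ) ^ 2 / (ε : ℝ) ^ 2) *
            ((AccelGreedy.dUpper f + AccelGreedy.dLower f) / AccelGreedy.dUpper f) ^ 2 *
            Real.log (Fintype.card E) ≤ m →
        (∀ y ∈ (AccelGreedy.acceleratedGreedy M f m order ε).support,
          (fun i => (y i : ℝ)) ∈ AccelGreedy.matroidPolytope M) ∧
        ENNReal.ofReal (1 - (Fintype.card E : ℝ) ^ (-c) / (ε : ℝ) ^ 3) ≤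
          (AccelGreedy.acceleratedGreedy M f m order ε).toOuterMeasure
            {y | (1 / Real.exp 1 - 2 * (ε : ℝ)) * f OPT ≤
              AccelGreedy.multilinearExt f fun i => (y i : ℝ)} := by
  -- With `s = ε d̄ / (4 r)`, an estimate fails with probability at most `2 n ^ (- C / 64)`, and
  -- there are at most `2 N³ r n ≤ 2 N³ n²` estimates.
  refine ⟨64 * (c + 4), by positivity, ?_⟩
  intro E _ _ _ M f OPT order ε m _ hr hf0 hf hd hOPT hmax hloop hnodup horder ⟨N, hN0, hεN⟩ hm hmC
  have hN0' : (0 : ℝ) < N := by exact_mod_cast hN0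
  have hr' : (0 : ℝ) < AccelGreedy.rk M := by exact_mod_cast hr
  have hε : 0 < (ε : ℝ) := by
    rw [hεN]
    positivity
  have hN : (N : ℝ) * ε = 1 := by
    rw [hεN]
    field_simp
  have hfloor : ⌊1 / (ε : ℝ)⌋₊ = N := by rw [hεN, one_div_one_div, Nat.floor_natCast]
  rw [AccelGreedy.acceleratedGreedy, hfloor]
  refine ⟨fun y hy => AccelGreedy.greedyLoop_support_subset_matroidPolytope hN hy, ?_⟩
  have hn1 : 1 ≤ Fintype.card E := Fintype.card_pos
  rcases hn1.eq_or_lt with hn | hn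
  · rw [← hn, Nat.cast_one, Real.one_rpow, ENNReal.ofReal_of_nonpos]
    · exact zero_le
    · have h1 : (ε : ℝ) ^ 3 ≤ 1 := pow_le_one₀ hε.le ε.2.2
      have h2 := one_le_one_div (pow_pos hε 3) h1
      linarith
  have hn2 : (2 : ℝ) ≤ Fintype.card E := by exact_mod_cast hn
  have hn0 : (0 : ℝ) < Fintype.card E := by linarith
  set n : ℝ := ((Fintype.card E : ℕ) : ℝ) with hn_def
  set d := AccelGreedy.dUpper f with hd_def
  set R := d + AccelGreedy.dLower f with hR_def
  set r : ℝ := ((AccelGreedy.rk M : ℕ) : ℝ) with hr_def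
  have hdR : d ≤ R := by linarith [AccelGreedy.dLower_nonneg f]
  have hR : 0 < R := hd.trans_le hdR
  have hr1 : 1 ≤ r := by
    rw [hr_def]
    exact_mod_cast hr
  have hrn : r ≤ n := by
    rw [hr_def, hn_def]
    exact_mod_cast AccelGreedy.rk_le_card M
  have hdOPT : d ≤ f OPT := by
    refine Finset.sup'_le _ _ fun e _ => ?_
    by_cases he : M.Indep {e}
    · exact hmax {e} (by simpa using he)
    · exact hloop e he
  have hsR : ε * d / (4 * r) ≤ 2 * R := by
    rw [div_le_iff₀ (by positivity)]
    have h1 : ε * d ≤ d := mul_le_of_le_one_left hd.le ε.2.2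
    nlinarith
  have hexp : Real.exp (-(m * (ε * d / (4 * r)) ^ 2 / (4 * R ^ 2))) ≤ n ^ (-(c + 4)) := by
    rw [Real.rpow_def_of_pos hn0]
    refine Real.exp_le_exp.2 ?_
    have h1 := mul_le_mul_of_nonneg_right hmC
      (by positivity : 0 ≤ (ε * d / (4 * r)) ^ 2 / (4 * R ^ 2))
    have h2 : 64 * (c + 4) * (r ^ 2 / (ε : ℝ) ^ 2) * (R / d) ^ 2 * Real.log n *
        ((ε * d / (4 * r)) ^ 2 / (4 * R ^ 2)) = (c + 4) * Real.log n := by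
      field_simp
      ring
    rw [h2, ← mul_div_assoc] at h1
    linarith
  have hest : ∀ (z : E → unitInterval) (e : E), (AccelGreedy.estimate f m z e).toOuterMeasure
      {x | ¬ |x - AccelGreedy.multilinearExt (fun S => AccelGreedy.marginal f S e)
        (fun i => (z i : ℝ))| ≤ ε * d / (4 * r)} ≤ ENNReal.ofReal (2 * n ^ (-(c + 4))) := by
    intro z e
    refine (AccelGreedy.estimate_toOuterMeasure_le f hm z e hR (by positivity) hsR
      fun S T => ?_).trans ?_
    · linarith [hf.marginal_le_dUpper hf0 S e, AccelGreedy.neg_marginal_le_dLower f T e]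
    · rw [ENNReal.ofReal_mul zero_le_two, ENNReal.ofReal_ofNat]
      gcongr
  have hlen : order.length = Fintype.card E := by
    rw [← List.toFinset_card_of_nodup hnodup, ← Finset.card_univ]
    congr 1
    ext e
    simp [horder e]
  have hfail := AccelGreedy.greedyLoop_toOuterMeasure_le hf hf0 hd hdOPT hOPT hr hN hε hest horder
    le_rfl
  have hgood := AccelGreedy.one_sub_le_toOuterMeasure hfail
  refine le_trans (le_trans ?_ hgood) (MeasureTheory.measure_mono fun y hy =>
    AccelGreedy.LoopInv.le_multilinearExt (hf0 OPT) hN hε hy)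
  have htotal : ((N : ℕ) : ℝ≥0∞) * ((2 * N ^ 2 * AccelGreedy.rk M : ℕ) *
      (order.length * ENNReal.ofReal (2 * n ^ (-(c + 4))))) =
      ENNReal.ofReal (N * ((2 * N ^ 2 * r) * (n * (2 * n ^ (-(c + 4)))))) := by
    generalize 2 * n ^ (-(c + 4)) = b
    rw [hlen, ENNReal.ofReal_mul (by positivity), ENNReal.ofReal_mul (by positivity),
      ENNReal.ofReal_mul hn0.le, ENNReal.ofReal_natCast, hn_def, ENNReal.ofReal_natCast, hr_def]
    congr 2
    rw [← ENNReal.ofReal_natCast]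
    push_cast
    rfl
  rw [htotal, ← ENNReal.ofReal_one, ← ENNReal.ofReal_sub _ (by positivity)]
  refine ENNReal.ofReal_le_ofReal (sub_le_sub_left ?_ _)
  have hpow : n ^ (-c) = n ^ (-(c + 4)) * n ^ 4 := by
    rw [← Real.rpow_natCast n 4, ← Real.rpow_add hn0]
    congr 1
    push_cast
    ring
  have hε3 : n ^ (-c) / (ε : ℝ) ^ 3 = N ^ 3 * n ^ (-c) := by
    rw [hεN]
    field_simp
  rw [hε3, hpow]
  have h1 : 4 * (r * n) ≤ n ^ 4 := by
    have h2 : r * n ≤ n ^ 2 := by nlinarith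
    have h3 : 4 ≤ n ^ 2 := by nlinarith
    nlinarith
  have h2 := mul_le_mul_of_nonneg_left h1
    (by positivity : 0 ≤ (N : ℝ) ^ 3 * n ^ (-(c + 4)))
  linarith
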